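/- Let $n\ge 1$, $a,b>0$, $p,q\in[1,\infty]$, $\alpha>2$, and let $\beta$ be defined by $\frac1\alpha+\frac1\beta=1$. Let $\delta>0$ and let $Q$ be a polynomial on $\mathbb{R}^n$ (with complex coefficients) that is not identically zero. Write $|x|$ for the Euclidean norm and $\widehat f(y)=\int_{\mathbb{R}^n} f(x)e^{-i x\cdot y}\,dx$. For a measurable function $f:\mathbb{R}^n\to\mathbb{C}$ consider the conditions (i) $\int_{\mathbb{R}^n} e^{pa|x|^\alpha}|f(x)|^p\,dx<\infty$ (for $p=\infty$: $e^{a|x|^\alpha}f(x)$ is essentially bounded); (ii) $\int_{\mathbb{R}^n} e^{qb|y|^\beta}|\widehat f(y)|^q|Q(y)|^\delta\,dy<\infty$ (for $q=\infty$: $e^{b|y|^\beta}|\widehat f(y)||Q(y)|^\delta$ is essentially bounded). (Condition (i) implies $f\in L^1(\mathbb{R}^n)$, so $\widehat f$ is well defined.) If $(a\alpha)^{1/\alpha}(b\beta)^{1/\beta}>\left(\sin\frac{\pi}{2}(\beta-1)\right)^{1/\beta}$, then every measurable $f$ satisfying (i) and (ii) vanishes almost everywhere. If $(a\alpha)^{1/\alpha}(b\beta)^{1/\beta}=\left(\sin\frac{\pi}{2}(\beta-1)\right)^{1/\beta}$,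 then there are infinitely many measurable functions satisfying (i) and (ii) that are linearly independent over $\mathbb{C}$ modulo equality almost everywhere. -/

import Mathlib

open MeasureTheory
open scoped ENNReal

noncomputable section

/-- The Fourier transform on `ℝⁿ` in the normalization
`f̂ y = ∫ f x * exp (-i x·y) dx` (no factor `2π`). -/
def fourierHat {n : ℕ} (f : EuclideanSpace ℝ (Fin n) → ℂ)
    (y : EuclideanSpace ℝ (Fin n)) : ℂ :=
  ∫ x, f x * Complex.exp (-Complex.I * ((inner ℝ x y : ℝ) : ℂ))

/-- The absolute value `|Q y|` of a polynomial (with complex, in particular possibly real,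
coefficients) at a point `y` of `ℝⁿ`. -/
def polyAbs {n : ℕ} (Q : MvPolynomial (Fin n) ℂ) (y : EuclideanSpace ℝ (Fin n)) : ℝ :=
  ‖MvPolynomial.eval (fun i => ((y i : ℝ) : ℂ)) Q‖

/-- `exp (a |x|^α) * f` lies in `L^p(ℝⁿ)`: for finite `p` this is
`∫ exp (p a |x|^α) |f x|^p dx < ∞`, for `p = ∞` the product is essentially bounded. -/
def SpaceDecay {n : ℕ} (a α : ℝ) (p : ℝ≥0∞) (f : EuclideanSpace ℝ (Fin n) → ℂ) : Prop :=
  MemLp (fun x => ((Real.exp (a * ‖x‖ ^ α) : ℝ) : ℂ) * f x) p volume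

/-- The weighted decay condition on the Fourier transform: for finite `q` it is
`∫ exp (q b |y|^β) |f̂ y|^q |Q y|^δ dy < ∞`, and for `q = ∞` it says that
`exp (b |y|^β) |f̂ y| |Q y|^δ` is essentially bounded. -/
def FourierDecay {n : ℕ} (b β δ : ℝ) (q : ℝ≥0∞) (Q : MvPolynomial (Fin n) ℂ)
    (f : EuclideanSpace ℝ (Fin n) → ℂ) : Prop :=
  (q ≠ ∞ → ∫⁻ y : EuclideanSpace ℝ (Fin n), ENNReal.ofReal
      (Real.exp (q.toReal * b * ‖y‖ ^ β) * ‖fourierHat f y‖ ^ q.toReal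
        * polyAbs Q y ^ δ) < ∞) ∧
  (q = ∞ → ∃ C : ℝ, ∀ᵐ y : EuclideanSpace ℝ (Fin n),
      Real.exp (b * ‖y‖ ^ β) * ‖fourierHat f y‖ * polyAbs Q y ^ δ ≤ C)

end

/-! Uniqueness. By Young's inequality `f̂` extends to an entire function along each complex line
parallel to the first axis, of growth `exp (c |Im z|^β)` with `c = (aα)^(-β/α) / β`
(`norm_lineFourier_le`). By Fubini, almost every real line carries an integrable bound with weight
`exp (b |t|^β)`; the factor `|Q|^δ` is harmless because `Q` restricted to almost every such line is
a nonzero polynomial, hence bounded below far out. With `S = sin (π/2 (β-1))`, the strict inequality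
says exactly `c S < b`. Multiplying by `exp (-K w^β)` in a half-plane, with `K = b / S`, then keeps
the function bounded on the boundary line and makes it decay superexponentially along the axis, so
Phragmén–Lindelöf forces it to vanish (`entire_eq_zero_of_pointwise_decay`). A small loss in `a` and
`b` reduces all `p`, `q` to `L¹` conditions.

Sharpness. The examples are radial superpositions of Gaussians, the integrals of `exp (-s e^w +
e^(σw) / σ + ν w)` over a contour, with `s = ℓ |x|²` and `σ = α / (α - 2)`. The Fourier transform of
each Gaussian replaces `-s e^w` by `-t e^(-w)`, with `t = |y|² / (4ℓ)`, and shifts `ν`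
(`fourierHat_saddleIntegral`). A horizontal translation of the contour normalizes the saddle points.
On the space side the saddle is `w = 0` and gives `exp (-a |x|^α)`. On the frequency side there are
two saddles `± iπ / (σ + 1)`, and `cos (π / (σ + 1)) = S` yields exactly the critical `b`. A very
negative `ν` adds any desired polynomial decay, which absorbs `Q` and all `p`, `q`.

Taking the parameters `ν - σ j` gives an independent family: derivatives of all orders at `s = 0`
turn a linear relation into one among the values `Γ(x - j)` for arbitrarily large `x`, and these
have different growth (`eq_zero_of_sum_saddleIntegral_eq_zero`). -/

/-! ### Vanishing of entire functions by Phragmén–Lindelöf. -/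

open Filter Topology Asymptotics in
/-- An entire function which grows at most like `exp (c |Im z|^β)` and decays on the real line like
`exp (-b |x|^β)` with `c * sin (π / 2 * (β - 1)) < b` vanishes on the real line. -/
theorem entire_eq_zero_of_pointwise_decay {Φ : ℂ → ℂ} (hΦ : Differentiable ℂ Φ)
    {β b c C D : ℝ} (h1 : 1 < β) (h2 : β < 2) (hc : 0 ≤ c)
    (hbc : c * Real.sin (Real.pi / 2 * (β - 1)) < b)
    (hC : ∀ z : ℂ, ‖Φ z‖ ≤ C * Real.exp (c * |z.im| ^ β))
    (hD : ∀ x : ℝ, ‖Φ x‖ ≤ D * Real.exp (-b * |x| ^ β)) (x : ℝ) : Φ x = 0 := by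
  set S := Real.sin (Real.pi / 2 * (β - 1)) with hS
  have hSpos : 0 < S := by
    apply Real.sin_pos_of_pos_of_lt_pi
    · have := Real.pi_pos; have : 0 < β - 1 := by linarith
      positivity
    · nlinarith [Real.pi_pos]
  have hScos : Real.cos (β * (Real.pi / 2)) = -S := by
    rw [hS, ← Real.cos_add_pi_div_two]; congr 1; ring
  have hC0 : 0 ≤ C := by
    have := (norm_nonneg _).trans (hC 0)
    exact nonneg_of_mul_nonneg_left this (Real.exp_pos _)
  -- On the imaginary axis `Re (w^β) = -S |y|^β`, so `K S = b` is the largest compensation that the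
  -- decay on the real line permits; `c < K` is the strict hypothesis.
  set K := b / S with hK
  have hcK : c < K := by rwa [hK, lt_div_iff₀ hSpos]
  have hKS : K * S = b := by rw [hK]; field_simp
  have hK0 : 0 ≤ K := hc.trans hcK.le
  set G : ℂ → ℂ := fun w => Φ (Complex.I * w) * Complex.exp (-(K : ℂ) * w ^ (β : ℂ)) with hG
  have hcpow_norm : ∀ w : ℂ, ‖w ^ (β : ℂ)‖ = ‖w‖ ^ β := fun w =>
    Complex.norm_cpow_real w β
  have hd : DiffContOnCl ℂ G {z | 0 < z.re} := by
    constructor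
    · intro w hw
      have hw' : w ∈ Complex.slitPlane := Or.inl hw
      have hA : DifferentiableAt ℂ (fun w : ℂ => w ^ (β : ℂ)) w :=
        differentiableAt_id.cpow_const hw'
      exact ((hΦ _).comp w (by fun_prop : DifferentiableAt ℂ (fun w => Complex.I * w) w) |>.mul
        ((hA.const_mul _).cexp)).differentiableWithinAt
    · intro w hw
      rw [Complex.closure_setOfPred_lt_re] at hw
      have hA : ContinuousAt (fun w : ℂ => w ^ (β : ℂ)) w :=
        Complex.continuousAt_cpow_const_of_re_pos (Or.inl hw) (by simp; linarith)
      exact ((hΦ.continuous.comp (by fun_prop : Continuous (fun w => Complex.I * w))).continuousAt.mul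
        ((continuousAt_const.mul hA).cexp)).continuousWithinAt
  have key := PhragmenLindelof.eq_zero_on_right_half_plane_of_superexponential_decay hd
    ⟨β, h2, c + K, ?_⟩ ?_ ⟨D, ?_⟩
  -- The real line is the boundary of the rotated half-plane, which the conclusion of
  -- Phragmén–Lindelöf includes.
  · have hz := key (x := -Complex.I * x) (by simp)
    simp only [hG, Pi.zero_apply, mul_eq_zero, Complex.exp_ne_zero, or_false] at hz
    convert hz using 2
    rw [← mul_assoc]; simp
  · apply IsBigO.of_bound C
    refine Eventually.of_forall fun w => ?_
    rw [hG, Real.norm_eq_abs, abs_of_pos (Real.exp_pos _)]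
    simp only [norm_mul, Complex.norm_exp]
    rw [add_mul, Real.exp_add, ← mul_assoc]
    refine mul_le_mul ((hC _).trans ?_) ?_ (Real.exp_nonneg _) (by positivity)
    · gcongr
      simpa using Complex.abs_re_le_norm w
    · rw [Real.exp_le_exp]
      refine (Complex.re_le_norm _).trans ?_
      rw [norm_mul, hcpow_norm]
      simp [abs_of_nonneg hK0]
  · intro n
    -- Here `β > 1` is what beats every `exp (n x)`.
    have hlim : Tendsto (fun x : ℝ => C * Real.exp (x * (n - (K - c) * x ^ (β - 1)))) atTop
        (𝓝 (C * 0)) := by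
      refine (Real.tendsto_exp_atBot.comp ?_).const_mul C
      refine tendsto_id.atTop_mul_atBot₀ ?_
      have := (tendsto_rpow_atTop (by linarith : 0 < β - 1)).const_mul_atTop
        (by linarith : 0 < K - c)
      simpa [sub_eq_add_neg] using tendsto_atBot_add_const_left atTop (n : ℝ)
        (tendsto_neg_atTop_atBot.comp this)
    rw [mul_zero] at hlim
    refine squeeze_zero' (Eventually.of_forall fun x => by positivity) ?_ hlim
    filter_upwards [eventually_gt_atTop 0] with x hx
    have e1 : ‖Complex.exp (-(K : ℂ) * (x : ℂ) ^ (β : ℂ))‖ = Real.exp (-K * x ^ β) := by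
      rw [Complex.norm_exp, ← Complex.ofReal_cpow hx.le, ← Complex.ofReal_neg,
        ← Complex.ofReal_mul, Complex.ofReal_re]
    have e2 := hC (Complex.I * x)
    simp only [Complex.mul_im, Complex.I_re, Complex.I_im, Complex.ofReal_re, Complex.ofReal_im,
      zero_mul, one_mul, zero_add, abs_of_pos hx] at e2
    have e3 : x * x ^ (β - 1) = x ^ β := by
      rw [← Real.rpow_one_add' hx.le (by linarith)]; congr 1; ring
    simp only [hG, norm_mul, e1]
    calc Real.exp x ^ n * (‖Φ (Complex.I * x)‖ * Real.exp (-K * x ^ β))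
        ≤ Real.exp x ^ n * ((C * Real.exp (c * x ^ β)) * Real.exp (-K * x ^ β)) := by gcongr
      _ = C * Real.exp (x * (n - (K - c) * x ^ (β - 1))) := by
        rw [← Real.exp_nat_mul, mul_sub, mul_left_comm x, e3]
        have : n * x - (K - c) * x ^ β = n * x + (c * x ^ β + -K * x ^ β) := by ring
        rw [mul_comm x, this, Real.exp_add, Real.exp_add]; ring
  · intro y
    have e1 : ((y * Complex.I : ℂ) ^ (β : ℂ)).re = -(S * |y| ^ β) := by
      rw [Complex.cpow_ofReal_re]
      rcases lt_trichotomy y 0 with hy | rfl | hy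
      · have : (y * Complex.I : ℂ).arg = -(Real.pi / 2) := by
          have := Complex.arg_real_mul (-Complex.I) (neg_pos.2 hy)
          rw [Complex.arg_neg_I] at this
          rw [← this]; push_cast; ring_nf
        rw [this, neg_mul, Real.cos_neg, mul_comm (Real.pi / 2), hScos]
        simp [mul_comm]
      · simp [Real.zero_rpow (by linarith : β ≠ 0)]
      · rw [Complex.arg_real_mul _ hy, Complex.arg_I, mul_comm (Real.pi / 2), hScos]
        simp [mul_comm]
    have e2 : Complex.I * (y * Complex.I) = ((-y : ℝ) : ℂ) := by
      push_cast; linear_combination (y : ℂ) * Complex.I_mul_I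
    have e3 := hD (-y)
    rw [abs_neg] at e3
    simp only [hG, norm_mul, Complex.norm_exp, e2]
    rw [← Complex.ofReal_neg, Complex.re_ofReal_mul, e1]
    calc _ ≤ D * Real.exp (-b * |y| ^ β) * Real.exp (-K * -(S * |y| ^ β)) := by gcongr
      _ = D := by
        rw [mul_assoc, ← Real.exp_add, ← hKS]
        ring_nf; simp

/-- Moving the argument by at most one costs only a constant once the coefficient drops from `b` to
`b'`: either `v ≥ ρ u` with `ρ = (b' / b)^(1/β) < 1`, or `u ≤ 1 / (1 - ρ)`. -/
theorem exists_mul_rpow_le_mul_rpow_add {b b' β : ℝ} (hb' : 0 < b') (hb : b' < b) (hβ : 0 < β) :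
    ∃ C : ℝ, ∀ u v : ℝ, 0 ≤ u → 0 ≤ v → u ≤ v + 1 → b' * u ^ β ≤ b * v ^ β + C := by
  have hbpos : 0 < b := hb'.trans hb
  set ρ := (b' / b) ^ (1 / β) with hρ
  have hρ0 : 0 < ρ := Real.rpow_pos_of_pos (by positivity) _
  have hρ1 : ρ < 1 := Real.rpow_lt_one (by positivity) (by rwa [div_lt_one hbpos]) (by positivity)
  have hρβ : b * ρ ^ β = b' := by
    rw [hρ, ← Real.rpow_mul (by positivity), one_div_mul_cancel hβ.ne', Real.rpow_one]
    field_simp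
  refine ⟨b' * (1 / (1 - ρ)) ^ β, fun u v hu hv huv => ?_⟩
  have h1ρ : 0 < 1 - ρ := by linarith
  rcases le_or_gt (ρ * u) v with h | h
  · have : b' * u ^ β ≤ b * v ^ β := by
      rw [← hρβ, mul_assoc, ← Real.mul_rpow hρ0.le hu]
      gcongr
    have : 0 ≤ b' * (1 / (1 - ρ)) ^ β := by positivity
    linarith
  · have hu' : u ≤ 1 / (1 - ρ) := by
      rw [le_div_iff₀ h1ρ]; nlinarith
    have : b' * u ^ β ≤ b' * (1 / (1 - ρ)) ^ β := by gcongr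
    have : 0 ≤ b * v ^ β := by positivity
    linarith

open Filter Topology in
theorem differentiable_intervalIntegral_translate {Φ : ℂ → ℂ} (hΦ : Differentiable ℂ Φ) (h : ℝ) :
    Differentiable ℂ (fun z => ∫ t in (0 : ℝ)..h, Φ (z + t)) := by
  intro z₀
  have hcd : Continuous (deriv Φ) := (hΦ.contDiff (n := 1)).continuous_deriv le_rfl
  obtain ⟨B, hB⟩ := (isCompact_closedBall z₀ (1 + |h|)).exists_bound_of_continuousOn
    hcd.continuousOn
  have hcont : ∀ z : ℂ, Continuous fun t : ℝ => Φ (z + t) := fun z =>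
    hΦ.continuous.comp (by fun_prop)
  refine (intervalIntegral.hasDerivAt_integral_of_dominated_loc_of_deriv_le
    (F := fun z (t : ℝ) => Φ (z + t)) (F' := fun z (t : ℝ) => deriv Φ (z + t))
    (bound := fun _ => B) (Metric.ball_mem_nhds z₀ one_pos)
    (Eventually.of_forall fun z => (hcont z).aestronglyMeasurable)
    ((hcont z₀).intervalIntegrable _ _)
    (hcd.comp (by fun_prop)).aestronglyMeasurable
    (Eventually.of_forall fun t ht z hz => hB _ ?_) (by simp)
    (Eventually.of_forall fun t ht z hz => ?_)).2.differentiableAt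
  · rw [Metric.mem_closedBall, dist_eq_norm, add_sub_right_comm]
    refine (norm_add_le _ _).trans (add_le_add (mem_ball_iff_norm.1 hz).le ?_)
    rw [Complex.norm_real, Real.norm_eq_abs]
    have := Set.uIoc_subset_uIcc ht
    rw [Set.mem_uIcc] at this
    rcases this with ⟨h1, h2⟩ | ⟨h1, h2⟩
    · rw [abs_of_nonneg h1]; exact h2.trans (le_abs_self h)
    · rw [abs_of_nonpos h2]; exact (neg_le_neg h1).trans (neg_le_abs h)
  · exact (hΦ (z + t)).hasDerivAt.comp_add_const z (t : ℂ)

open Filter Topology in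
-- The averages of `Φ` over `[z, z + h]` are entire with the same growth, and the integral condition
-- becomes pointwise decay with a slightly smaller `b`. They therefore vanish for all small `h`, and
-- differentiating in `h` recovers `Φ`.
theorem entire_eq_zero_of_integrable_decay {Φ : ℂ → ℂ} (hΦ : Differentiable ℂ Φ)
    {β b c C : ℝ} (h1 : 1 < β) (h2 : β < 2) (hc : 0 ≤ c)
    (hbc : c * Real.sin (Real.pi / 2 * (β - 1)) < b)
    (hC : ∀ z : ℂ, ‖Φ z‖ ≤ C * Real.exp (c * |z.im| ^ β))
    (hI : Integrable (fun x : ℝ => Real.exp (b * |x| ^ β) * ‖Φ x‖)) (x : ℝ) : Φ x = 0 := by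
  set S := Real.sin (Real.pi / 2 * (β - 1)) with hS
  have hSpos : 0 < S := by
    apply Real.sin_pos_of_pos_of_lt_pi
    · have := Real.pi_pos; have : 0 < β - 1 := by linarith
      positivity
    · nlinarith [Real.pi_pos]
  have hcS : 0 ≤ c * S := by positivity
  set b' := (c * S + b) / 2 with hb'
  obtain ⟨C₁, hC₁⟩ := exists_mul_rpow_le_mul_rpow_add (b := b) (b' := b') (β := β)
    (by linarith) (by linarith) (by linarith)
  have hcont : Continuous fun t : ℝ => Φ t := hΦ.continuous.comp Complex.continuous_ofReal
  have hzero : ∀ h : ℝ, 0 < h → h < 1 → ∀ y : ℝ, ∫ t in (0 : ℝ)..h, Φ (y + t) = 0 := by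
    intro h h0 h1'
    refine entire_eq_zero_of_pointwise_decay (C := C)
      (D := Real.exp C₁ * ∫ t : ℝ, Real.exp (b * |t| ^ β) * ‖Φ t‖)
      (differentiable_intervalIntegral_translate hΦ h) h1 h2 hc (by linarith : c * S < b') ?_ ?_
    · intro z
      have := intervalIntegral.norm_integral_le_of_norm_le_const (a := 0) (b := h)
        (f := fun t : ℝ => Φ (z + t)) (C := C * Real.exp (c * |z.im| ^ β))
        fun t _ => by simpa using hC (z + t)
      rw [sub_zero, abs_of_pos h0] at this
      exact this.trans (mul_le_of_le_one_right ((norm_nonneg _).trans (hC z)) h1'.le)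
    · intro y
      have e1 : ∫ t in (0 : ℝ)..h, Φ (y + t) = ∫ t in y..(y + h), Φ t := by
        simpa using intervalIntegral.integral_comp_add_left (fun t : ℝ => Φ t) (a := 0) (b := h) y
      rw [e1, intervalIntegral.integral_of_le (by linarith)]
      have hI' := (hI.const_mul (Real.exp C₁ * Real.exp (-b' * |y| ^ β)))
      calc _ ≤ ∫ t in Set.Ioc y (y + h), ‖Φ t‖ := norm_integral_le_integral_norm _
        _ ≤ ∫ t in Set.Ioc y (y + h), Real.exp C₁ * Real.exp (-b' * |y| ^ β) *
            (Real.exp (b * |t| ^ β) * ‖Φ t‖) := by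
          refine setIntegral_mono_on ?_ hI'.integrableOn measurableSet_Ioc fun t ht => ?_
          · exact (hcont.norm.integrableOn_Icc).mono_set Set.Ioc_subset_Icc_self
          · rw [← mul_assoc, ← Real.exp_add, ← Real.exp_add]
            refine le_mul_of_one_le_left (norm_nonneg _) (Real.one_le_exp ?_)
            have := hC₁ |y| |t| (abs_nonneg _) (abs_nonneg _) (by
              have := abs_sub_abs_le_abs_sub y t
              have : |y - t| ≤ 1 := by rw [abs_le]; constructor <;> linarith [ht.1, ht.2]
              linarith)
            linarith
        _ ≤ ∫ t : ℝ, Real.exp C₁ * Real.exp (-b' * |y| ^ β) *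
            (Real.exp (b * |t| ^ β) * ‖Φ t‖) :=
          setIntegral_le_integral hI' (Eventually.of_forall fun t => by positivity)
        _ = _ := by rw [integral_const_mul]; ring
  -- The averages vanish for `0 < h < 1`, so the derivative is taken at the interior point `h =
  -- 1/2`, with base point `x - 1/2` so that the endpoint is `x`.
  have hder := intervalIntegral.integral_hasDerivAt_right (f := fun t : ℝ => Φ ((x - 1 / 2 : ℝ) + t))
    (a := 0) (b := 1 / 2) (Continuous.intervalIntegrable (hΦ.continuous.comp (by fun_prop)) _ _)
    (Continuous.stronglyMeasurableAtFilter (hΦ.continuous.comp (by fun_prop)) _ _)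
    (Continuous.continuousAt (hΦ.continuous.comp (by fun_prop)))
  have hder0 : HasDerivAt (fun u : ℝ => ∫ t in (0 : ℝ)..u, Φ ((x - 1 / 2 : ℝ) + t)) 0 (1 / 2) := by
    refine (hasDerivAt_const (1 / 2 : ℝ) (0 : ℂ)).congr_of_eventuallyEq ?_
    filter_upwards [Ioo_mem_nhds (by norm_num : (0 : ℝ) < 1 / 2) (by norm_num : (1 / 2 : ℝ) < 1)]
      with u hu using hzero u hu.1 hu.2 (x - 1 / 2)
  have := hder.unique hder0
  rwa [← Complex.ofReal_add, sub_add_cancel] at this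

/-! ### Polynomials on lines parallel to the first axis. -/

theorem measurePreserving_fin_cons (m : ℕ) :
    MeasurePreserving (fun p : (Fin m → ℝ) × ℝ => (Fin.cons p.2 p.1 : Fin (m + 1) → ℝ))
      (volume.prod volume) volume := by
  have h := (volume_preserving_piFinSuccAbove (fun _ : Fin (m + 1) => ℝ) 0).symm.comp
    (Measure.measurePreserving_swap (μ := (volume : Measure (Fin m → ℝ)))
      (ν := (volume : Measure ℝ)))
  convert! h using 1
  funext p
  exact (Fin.insertNth_zero (α := fun _ => ℝ) p.2 p.1).symm

/-- The one-variable polynomial obtained by fixing all but the first variable. -/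
noncomputable def linePolynomial {m : ℕ} (Q : MvPolynomial (Fin (m + 1)) ℂ) (y : Fin m → ℝ) : Polynomial ℂ :=
  (MvPolynomial.finSuccEquiv ℂ m Q).map (MvPolynomial.eval fun i => ((y i : ℝ) : ℂ))

theorem eval_linePolynomial {m : ℕ} (Q : MvPolynomial (Fin (m + 1)) ℂ) (y : Fin m → ℝ) (t : ℝ) :
    (linePolynomial Q y).eval (t : ℂ) =
      MvPolynomial.eval (fun i => (((Fin.cons t y : Fin (m + 1) → ℝ) i : ℝ) : ℂ)) Q := by
  rw [linePolynomial, ← MvPolynomial.eval_eq_eval_mv_eval']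
  congr 2
  ext i
  refine Fin.cases ?_ (fun j => ?_) i <;> simp

theorem MvPolynomial.continuous_eval_ofReal {m : ℕ} (Q : MvPolynomial (Fin m) ℂ) :
    Continuous fun y : Fin m → ℝ => MvPolynomial.eval (fun i => ((y i : ℝ) : ℂ)) Q :=
  (MvPolynomial.continuous_eval Q).comp
    (continuous_pi fun i => Complex.continuous_ofReal.comp (continuous_apply i))

open Filter in
-- Some coefficient of `Q`, as a polynomial in the first variable, is a nonzero polynomial in the
-- others. The lower-dimensional statement is kept as a hypothesis so that this can serve as its own
-- induction step.
theorem ae_linePolynomial_ne_zero_of_ae {m : ℕ} {Q : MvPolynomial (Fin (m + 1)) ℂ} (hQ : Q ≠ 0)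
    (ih : ∀ q : MvPolynomial (Fin m) ℂ, q ≠ 0 →
      ∀ᵐ y : Fin m → ℝ, MvPolynomial.eval (fun i => ((y i : ℝ) : ℂ)) q ≠ 0) :
    ∀ᵐ y : Fin m → ℝ, linePolynomial Q y ≠ 0 := by
  have h1 : MvPolynomial.finSuccEquiv ℂ m Q ≠ 0 := by simpa using hQ
  obtain ⟨k, hk⟩ : ∃ k, (MvPolynomial.finSuccEquiv ℂ m Q).coeff k ≠ 0 := by
    by_contra! h
    exact h1 (Polynomial.ext (by simpa using h))
  filter_upwards [ih _ hk] with y hy h0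
  apply hy
  have := congrArg (fun p => Polynomial.coeff p k) h0
  simpa [linePolynomial, Polynomial.coeff_map] using this

open Filter in
-- Fubini: on almost every line the restriction is a nonzero polynomial in one variable, with
-- finitely many zeros.
theorem MvPolynomial.ae_eval_ofReal_ne_zero {m : ℕ} {Q : MvPolynomial (Fin m) ℂ} (hQ : Q ≠ 0) :
    ∀ᵐ y : Fin m → ℝ, MvPolynomial.eval (fun i => ((y i : ℝ) : ℂ)) Q ≠ 0 := by
  induction m with
  | zero =>
    refine Eventually.of_forall fun y => ?_
    obtain ⟨c, rfl⟩ := MvPolynomial.C_surjective (Fin 0) Q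
    simpa using hQ
  | succ m ih =>
    have hmeas : MeasurableSet {y : Fin (m + 1) → ℝ |
        MvPolynomial.eval (fun i => ((y i : ℝ) : ℂ)) Q ≠ 0} :=
      (isOpen_ne.preimage (MvPolynomial.continuous_eval_ofReal Q)).measurableSet
    have hmp := measurePreserving_fin_cons m
    rw [← hmp.map_eq, ae_map_iff hmp.measurable.aemeasurable hmeas,
      Measure.ae_prod_iff_ae_ae (by exact hmp.measurable hmeas)]
    filter_upwards [ae_linePolynomial_ne_zero_of_ae hQ fun q hq => ih hq] with y hy
    have hfin : {t : ℝ | (linePolynomial Q y).eval (t : ℂ) = 0}.Finite := by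
      have := (Polynomial.finite_setOfPred_isRoot hy).preimage (Complex.ofReal_injective.injOn)
      exact this
    refine (measure_mono_null (fun t ht => ?_) (hfin.measure_zero volume))
    simpa [eval_linePolynomial] using ht

theorem ae_linePolynomial_ne_zero {m : ℕ} {Q : MvPolynomial (Fin (m + 1)) ℂ} (hQ : Q ≠ 0) :
    ∀ᵐ y : Fin m → ℝ, linePolynomial Q y ≠ 0 :=
  ae_linePolynomial_ne_zero_of_ae hQ fun _ hq => MvPolynomial.ae_eval_ofReal_ne_zero hq

open Filter Topology in
theorem Polynomial.exists_forall_le_norm_eval_ofReal {P : Polynomial ℂ} (hP : P ≠ 0) :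
    ∃ c > 0, ∃ R > 0, ∀ t : ℝ, R ≤ |t| → c ≤ ‖P.eval (t : ℂ)‖ := by
  rcases lt_or_ge 0 P.degree with h | h
  · have h1 := (P.tendsto_norm_atTop h tendsto_norm_cobounded_atTop).eventually_ge_atTop 1
    rw [Metric.cobounded_eq_cocompact] at h1
    obtain ⟨R, hR⟩ := (Metric.hasBasis_cobounded_compl_closedBall (0 : ℂ)).eventually_iff.1
      (Metric.cobounded_eq_cocompact (α := ℂ) ▸ h1)
    refine ⟨1, one_pos, max R 0 + 1, by positivity, fun t ht => hR.2 ?_⟩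
    simp
    have := le_max_left R 0
    linarith
  · rw [Polynomial.eq_C_of_degree_le_zero h] at hP ⊢
    have : P.coeff 0 ≠ 0 := by simpa using hP
    exact ⟨‖P.coeff 0‖, by positivity, 1, one_pos, fun t _ => by simp⟩

/-! ### Fourier injectivity and reduction to weighted `L¹` conditions. -/

/-- The Fourier transform is injective on `L¹`. -/
theorem ae_eq_zero_of_fourierHat_eq_zero {n : ℕ} {f : EuclideanSpace ℝ (Fin n) → ℂ}
    (hf : Integrable f) (h : ∀ y, fourierHat f y = 0) : f =ᵐ[volume] 0 := by
  -- Mathlib's transform has `2π` in the exponent, hence the dilation.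
  have hF : ∀ y, FourierTransform.fourier f y = 0 := fun y => by
    rw [Real.fourier_eq', ← h ((2 * Real.pi) • y), fourierHat]
    congr 1; ext x
    rw [inner_smul_right, smul_eq_mul, mul_comm]
    congr 2
    push_cast; ring
  apply ae_eq_zero_of_integral_contDiff_smul_eq_zero hf.locallyIntegrable
  intro g hg hgc
  have hg₁ : HasCompactSupport (Complex.ofRealCLM ∘ g) := hgc.comp_left rfl
  have hg₂ : ContDiff ℝ (↑(⊤ : ℕ∞)) (Complex.ofRealCLM ∘ g) := by fun_prop
  -- A test function is the transform of a Schwartz function `ψ`, so pairing it with `f` equals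
  -- pairing `ψ` with `f̂ = 0`.
  set φ : SchwartzMap (EuclideanSpace ℝ (Fin n)) ℂ := hg₁.toSchwartzMap hg₂ with hφ
  set ψ := FourierTransformInv.fourierInv φ with hψ
  have hψφ : FourierTransform.fourier ψ = φ := by simp [hψ]
  have hflip := VectorFourier.integral_fourierIntegral_smul_eq_flip (e := Real.fourierChar)
    (L := innerₗ (EuclideanSpace ℝ (Fin n))) (μ := volume) (ν := volume)
    (f := (ψ : EuclideanSpace ℝ (Fin n) → ℂ)) (g := f) Real.continuous_fourierChar
    continuous_inner ψ.integrable hf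
  rw [flip_innerₗ] at hflip
  calc ∫ x, g x • f x = ∫ x, (φ x) • f x := by simp [hφ]
    _ = ∫ x, ψ x • FourierTransform.fourier f x := by
      rw [← hψφ, SchwartzMap.fourier_coe]; exact hflip
    _ = 0 := by simp [hF]

theorem integrable_exp_neg_mul_norm_rpow {m : ℕ} {ε κ : ℝ} (hε : 0 < ε) (hκ : 0 < κ) :
    Integrable fun x : EuclideanSpace ℝ (Fin (m + 1)) => Real.exp (-ε * ‖x‖ ^ κ) := by
  rw [integrable_fun_norm_addHaar volume (f := fun r : ℝ => Real.exp (-ε * r ^ κ))]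
  have := integrableOn_rpow_mul_exp_neg_mul_rpow (p := κ) (s := m) (b := ε)
    (by have : (0 : ℝ) ≤ m := m.cast_nonneg
        linarith) hκ hε
  simpa using this

open Filter in
-- The loss `a - a'` supplies an integrable factor `E ≤ 1`. For finite `p` the bound `E T ≤ E + T^p`
-- (split at `T = 1`) takes the place of Hölder's inequality.
theorem SpaceDecay.integrable {m : ℕ} {a a' α : ℝ} {p : ℝ≥0∞}
    {f : EuclideanSpace ℝ (Fin (m + 1)) → ℂ} (hf : SpaceDecay a α p f) (hp : 1 ≤ p)
    (hfm : AEStronglyMeasurable f volume) (ha : a' < a) (hα : 0 < α) :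
    Integrable fun x => Real.exp (a' * ‖x‖ ^ α) * ‖f x‖ := by
  set T : EuclideanSpace ℝ (Fin (m + 1)) → ℂ :=
    fun x => ((Real.exp (a * ‖x‖ ^ α) : ℝ) : ℂ) * f x with hT
  have hTm : MemLp T p volume := hf
  have hE : Integrable fun x : EuclideanSpace ℝ (Fin (m + 1)) => Real.exp (-(a - a') * ‖x‖ ^ α) :=
    integrable_exp_neg_mul_norm_rpow (sub_pos.2 ha) hα
  have hcont : Continuous fun x : EuclideanSpace ℝ (Fin (m + 1)) => Real.exp (a' * ‖x‖ ^ α) := by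
    have := continuous_norm (E := EuclideanSpace ℝ (Fin (m + 1))).rpow_const
      fun _ => Or.inr hα.le
    fun_prop
  have hmeas : AEStronglyMeasurable (fun x => Real.exp (a' * ‖x‖ ^ α) * ‖f x‖) volume :=
    hcont.aestronglyMeasurable.mul hfm.norm
  have heq : ∀ x, Real.exp (a' * ‖x‖ ^ α) * ‖f x‖ =
      Real.exp (-(a - a') * ‖x‖ ^ α) * ‖T x‖ := fun x => by
    rw [hT, norm_mul, Complex.norm_real, Real.norm_eq_abs, abs_of_pos (Real.exp_pos _),
      ← mul_assoc, ← Real.exp_add]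
    ring_nf
  by_cases hpt : p = ∞
  · subst hpt
    obtain ⟨C, hC⟩ : ∃ C : ℝ, ∀ᵐ x, ‖T x‖ ≤ C := by
      refine ⟨(eLpNorm T ∞ volume).toReal, ?_⟩
      filter_upwards [ae_le_eLpNormEssSup (f := T) (μ := volume)] with x hx
      rw [eLpNorm_exponent_top]
      have := ENNReal.toReal_mono (by simpa using hTm.2.ne) hx
      simpa using this
    refine (hE.mul_const C).mono' hmeas ?_
    filter_upwards [hC] with x hx
    rw [heq, Real.norm_of_nonneg (by positivity)]
    gcongr
  · have hp0 : p ≠ 0 := (one_pos.trans_le hp).ne'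
    have hp1 : 1 ≤ p.toReal := by
      simpa using ENNReal.toReal_mono hpt hp
    refine (hE.add (hTm.integrable_norm_rpow hp0 hpt)).mono' hmeas (Eventually.of_forall fun x => ?_)
    rw [heq, Real.norm_of_nonneg (by positivity)]
    have h1 : Real.exp (-(a - a') * ‖x‖ ^ α) ≤ 1 := by
      rw [Real.exp_le_one_iff]
      have : 0 ≤ (a - a') * ‖x‖ ^ α := mul_nonneg (sub_pos.2 ha).le (by positivity)
      linarith
    have h2 : 0 ≤ ‖T x‖ ^ p.toReal := by positivity
    simp only [Pi.add_apply]
    rcases le_total ‖T x‖ 1 with h | h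
    · calc _ ≤ Real.exp (-(a - a') * ‖x‖ ^ α) * 1 := by gcongr
        _ ≤ _ := by linarith
    · calc _ ≤ 1 * ‖T x‖ ^ p.toReal := by
            gcongr
            exact Real.self_le_rpow_of_one_le h hp1
        _ ≤ _ := by rw [one_mul]; linarith [Real.exp_pos (-(a - a') * ‖x‖ ^ α)]

open Filter in
-- The same splitting on the frequency side. Only positivity of the exponent of `|Q|` matters later,
-- so it may change with `q`.
theorem FourierDecay.exists_lintegral_lt_top {m : ℕ} {b b' β δ : ℝ} {q : ℝ≥0∞}
    {Q : MvPolynomial (Fin (m + 1)) ℂ}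
    {f : EuclideanSpace ℝ (Fin (m + 1)) → ℂ} (hf : FourierDecay b β δ q Q f) (hq : 1 ≤ q)
    (hb : b' < b) (hβ : 0 < β) (hδ : 0 < δ) :
    ∃ δ' : ℝ, 0 < δ' ∧ ∫⁻ y : EuclideanSpace ℝ (Fin (m + 1)), ENNReal.ofReal
      (Real.exp (b' * ‖y‖ ^ β) * ‖fourierHat f y‖ * polyAbs Q y ^ δ') < ∞ := by
  have hE : ∫⁻ y : EuclideanSpace ℝ (Fin (m + 1)), ENNReal.ofReal
      (Real.exp (-(b - b') * ‖y‖ ^ β)) < ∞ := by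
    have := (integrable_exp_neg_mul_norm_rpow (m := m) (sub_pos.2 hb) hβ).lintegral_lt_top
    simpa using this
  have hmul : ∀ y : EuclideanSpace ℝ (Fin (m + 1)),
      Real.exp (b' * ‖y‖ ^ β) = Real.exp (-(b - b') * ‖y‖ ^ β) * Real.exp (b * ‖y‖ ^ β) :=
    fun y => by rw [← Real.exp_add]; ring_nf
  have hQ0 : ∀ y, 0 ≤ polyAbs Q y := fun y => norm_nonneg _
  by_cases hqt : q = ∞
  · obtain ⟨C, hC⟩ := hf.2 hqt
    refine ⟨δ, hδ, ?_⟩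
    calc _ ≤ ∫⁻ y : EuclideanSpace ℝ (Fin (m + 1)), ENNReal.ofReal
          (Real.exp (-(b - b') * ‖y‖ ^ β)) * ENNReal.ofReal C := by
          refine lintegral_mono_ae ?_
          filter_upwards [hC] with y hy
          rw [← ENNReal.ofReal_mul (Real.exp_nonneg _), hmul, mul_assoc, mul_assoc,
            ← mul_assoc (Real.exp (b * _))]
          gcongr
      _ = (∫⁻ y : EuclideanSpace ℝ (Fin (m + 1)), ENNReal.ofReal
          (Real.exp (-(b - b') * ‖y‖ ^ β))) * ENNReal.ofReal C :=
          lintegral_mul_const' _ _ ENNReal.ofReal_ne_top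
      _ < ∞ := ENNReal.mul_lt_top hE ENNReal.ofReal_lt_top
  · have hq1 : 1 ≤ q.toReal := by
      simpa using ENNReal.toReal_mono hqt hq
    have hq0 : 0 < q.toReal := one_pos.trans_le hq1
    -- With this exponent the given integrand is exactly `T ^ q`.
    refine ⟨δ / q.toReal, by positivity, ?_⟩
    have hI := hf.1 hqt
    refine lt_of_le_of_lt (lintegral_mono fun y => ?_)
      ((lintegral_add_left (f := fun y : EuclideanSpace ℝ (Fin (m + 1)) =>
        ENNReal.ofReal (Real.exp (-(b - b') * ‖y‖ ^ β))) (by fun_prop) _).trans_lt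
          (ENNReal.add_lt_top.2 ⟨hE, hI⟩))
    rw [← ENNReal.ofReal_add (Real.exp_nonneg _) (by have := hQ0 y; positivity)]
    apply ENNReal.ofReal_le_ofReal
    set T := Real.exp (b * ‖y‖ ^ β) * ‖fourierHat f y‖ * polyAbs Q y ^ (δ / q.toReal) with hT
    have hT0 : 0 ≤ T := by have := hQ0 y; positivity
    have hTq : T ^ q.toReal = Real.exp (q.toReal * b * ‖y‖ ^ β) * ‖fourierHat f y‖ ^ q.toReal
        * polyAbs Q y ^ δ := by
      have := hQ0 y
      rw [hT, Real.mul_rpow (by positivity) (by positivity),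
        Real.mul_rpow (by positivity) (by positivity), ← Real.rpow_mul this,
        div_mul_cancel₀ _ hq0.ne', ← Real.exp_mul]
      ring_nf
    rw [← hTq, hmul, mul_assoc, mul_assoc, ← mul_assoc (Real.exp (b * _)), ← hT]
    have h1 : Real.exp (-(b - b') * ‖y‖ ^ β) ≤ 1 := by
      rw [Real.exp_le_one_iff]
      have : 0 ≤ (b - b') * ‖y‖ ^ β := mul_nonneg (sub_pos.2 hb).le (by positivity)
      linarith
    have h2 : 0 ≤ T ^ q.toReal := by positivity
    rcases le_total T 1 with h | h
    · calc _ ≤ Real.exp (-(b - b') * ‖y‖ ^ β) * 1 := by gcongr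
        _ ≤ _ := by linarith
    · calc _ ≤ 1 * T ^ q.toReal := by
            gcongr
            exact Real.self_le_rpow_of_one_le h hq1
        _ ≤ _ := by rw [one_mul]; linarith [Real.exp_pos (-(b - b') * ‖y‖ ^ β)]

/-! ### Entire extension along lines, and the uniqueness half. -/

/-- The Fourier transform along a complex line in the direction of the first coordinate. -/
noncomputable def lineFourier {m : ℕ} (f : EuclideanSpace ℝ (Fin (m + 1)) → ℂ)
    (y : EuclideanSpace ℝ (Fin (m + 1))) (z : ℂ) : ℂ :=
  ∫ x, f x * Complex.exp (-Complex.I * ((inner ℝ x y : ℝ) : ℂ)) *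
    Complex.exp (-Complex.I * z * ((x 0 : ℝ) : ℂ))

theorem fourierHat_cons {m : ℕ} (f : EuclideanSpace ℝ (Fin (m + 1)) → ℂ) (y : Fin m → ℝ) (t : ℝ) :
    fourierHat f (WithLp.toLp 2 (Fin.cons t y)) =
      lineFourier f (WithLp.toLp 2 (Fin.cons 0 y)) t := by
  unfold fourierHat lineFourier
  congr 1; ext x
  rw [mul_assoc, ← Complex.exp_add]
  congr 2
  simp only [PiLp.inner_apply, Fin.sum_univ_succ, Fin.cons_zero, Fin.cons_succ]
  simp
  ring

theorem norm_exp_neg_I_mul_mul (z : ℂ) (t : ℝ) :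
    ‖Complex.exp (-Complex.I * z * (t : ℂ))‖ = Real.exp (z.im * t) := by
  rw [Complex.norm_exp]; simp

/-- Young's inequality for `(aα)^(1/α) u` and `(aα)^(-1/α) v`. This scaling gives `u^α` the
coefficient `a` and so fixes the growth constant of the entire extension. -/
theorem mul_le_rpow_add_rpow {a α β u v : ℝ} (ha : 0 < a) (hα : 0 < α) (h : α.HolderConjugate β)
    (hu : 0 ≤ u) (hv : 0 ≤ v) :
    u * v ≤ a * u ^ α + (a * α) ^ (-β / α) / β * v ^ β := by
  have haα : 0 < a * α := by positivity
  have := Real.young_inequality_of_nonneg (a := (a * α) ^ (1 / α) * u)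
    (b := (a * α) ^ (-1 / α) * v) (by positivity) (by positivity) h
  rw [Real.mul_rpow (by positivity) hu, Real.mul_rpow (by positivity) hv,
    ← Real.rpow_mul haα.le, ← Real.rpow_mul haα.le, one_div_mul_cancel hα.ne', Real.rpow_one] at this
  have e : (a * α) ^ (1 / α) * u * ((a * α) ^ (-1 / α) * v) = u * v := by
    rw [mul_mul_mul_comm, ← Real.rpow_add haα, ← add_div]; simp
  rw [e] at this
  convert this using 2
  · field_simp
  · rw [show -1 / α * β = -β / α by ring]; ring

theorem norm_coord_le {m : ℕ} (x : EuclideanSpace ℝ (Fin (m + 1))) (i : Fin (m + 1)) :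
    |x i| ≤ ‖x‖ := by
  simpa using PiLp.norm_apply_le x i

theorem exp_mul_le_of_young {m : ℕ} {a α β : ℝ} (ha : 0 < a) (h : α.HolderConjugate β)
    (s : ℝ) (x : EuclideanSpace ℝ (Fin (m + 1))) :
    Real.exp (s * x 0) ≤
      Real.exp ((a * α) ^ (-β / α) / β * |s| ^ β) * Real.exp (a * ‖x‖ ^ α) := by
  rw [← Real.exp_add, Real.exp_le_exp]
  have h1 := mul_le_rpow_add_rpow ha h.pos h (norm_nonneg x) (abs_nonneg s)
  have h2 : s * x 0 ≤ ‖x‖ * |s| := by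
    calc s * x 0 ≤ |s * x 0| := le_abs_self _
      _ = |x 0| * |s| := by rw [abs_mul, mul_comm]
      _ ≤ _ := by gcongr; exact norm_coord_le x 0
  linarith

theorem aestronglyMeasurable_lineFourier_integrand {m : ℕ}
    {f : EuclideanSpace ℝ (Fin (m + 1)) → ℂ} (hfm : AEStronglyMeasurable f volume)
    (y : EuclideanSpace ℝ (Fin (m + 1))) (z : ℂ) :
    AEStronglyMeasurable (fun x => f x * Complex.exp (-Complex.I * ((inner ℝ x y : ℝ) : ℂ)) *
    Complex.exp (-Complex.I * z * ((x 0 : ℝ) : ℂ))) volume := by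
  refine (hfm.mul (Continuous.aestronglyMeasurable ?_)).mul (Continuous.aestronglyMeasurable ?_)
  · fun_prop
  · fun_prop

theorem norm_lineFourier_integrand {m : ℕ} (f : EuclideanSpace ℝ (Fin (m + 1)) → ℂ)
    (x y : EuclideanSpace ℝ (Fin (m + 1))) (z : ℂ) :
    ‖f x * Complex.exp (-Complex.I * ((inner ℝ x y : ℝ) : ℂ)) *
      Complex.exp (-Complex.I * z * ((x 0 : ℝ) : ℂ))‖ = ‖f x‖ * Real.exp (z.im * x 0) := by
  rw [norm_mul, norm_mul, norm_exp_neg_I_mul_mul, Complex.norm_exp]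
  simp

theorem norm_lineFourier_le {m : ℕ} {a α β : ℝ} (ha : 0 < a) (h : α.HolderConjugate β)
    {f : EuclideanSpace ℝ (Fin (m + 1)) → ℂ}
    (hf : Integrable fun x => Real.exp (a * ‖x‖ ^ α) * ‖f x‖)
    (y : EuclideanSpace ℝ (Fin (m + 1))) (z : ℂ) :
    ‖lineFourier f y z‖ ≤ (∫ x, Real.exp (a * ‖x‖ ^ α) * ‖f x‖) *
      Real.exp ((a * α) ^ (-β / α) / β * |z.im| ^ β) := by
  rw [← integral_mul_const]
  refine norm_integral_le_of_norm_le (hf.mul_const _) (Filter.Eventually.of_forall fun x => ?_)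
  rw [norm_lineFourier_integrand]
  calc _ ≤ ‖f x‖ * (Real.exp ((a * α) ^ (-β / α) / β * |z.im| ^ β) * Real.exp (a * ‖x‖ ^ α)) := by
        gcongr; exact exp_mul_le_of_young ha h _ _
    _ = _ := by ring

open Filter in
theorem differentiable_lineFourier {m : ℕ} {a α β : ℝ} (ha : 0 < a) (h : α.HolderConjugate β)
    {f : EuclideanSpace ℝ (Fin (m + 1)) → ℂ} (hfm : AEStronglyMeasurable f volume)
    (hf : Integrable fun x => Real.exp (a * ‖x‖ ^ α) * ‖f x‖)
    (y : EuclideanSpace ℝ (Fin (m + 1))) : Differentiable ℂ (lineFourier f y) := by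
  intro z₀
  set c := (a * α) ^ (-β / α) / β
  -- One unit for the radius of the ball around `z₀`, one for the factor `|x 0| ≤ exp (x 0) + exp
  -- (-x 0)` produced by differentiation.
  set M := |z₀.im| + 2
  have hmeas0 : ∀ z, AEStronglyMeasurable _ volume :=
    fun z => aestronglyMeasurable_lineFourier_integrand hfm y z
  refine (hasDerivAt_integral_of_dominated_loc_of_deriv_le
    (F := fun (z : ℂ) (x : EuclideanSpace ℝ (Fin (m + 1))) =>
      f x * Complex.exp (-Complex.I * ((inner ℝ x y : ℝ) : ℂ)) *
      Complex.exp (-Complex.I * z * ((x 0 : ℝ) : ℂ)))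
    (F' := fun (z : ℂ) (x : EuclideanSpace ℝ (Fin (m + 1))) =>
      f x * Complex.exp (-Complex.I * ((inner ℝ x y : ℝ) : ℂ)) *
      (Complex.exp (-Complex.I * z * ((x 0 : ℝ) : ℂ)) * (-Complex.I * ((x 0 : ℝ) : ℂ))))
    (bound := fun x => 2 * Real.exp (c * M ^ β) * (Real.exp (a * ‖x‖ ^ α) * ‖f x‖))
    (Metric.ball_mem_nhds z₀ one_pos)
    (Eventually.of_forall hmeas0) ?_ ?_ (Eventually.of_forall fun x z hz => ?_) (hf.const_mul _)
    (Eventually.of_forall fun x z hz => ?_)).2.differentiableAt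
  · refine (hf.const_mul (Real.exp (c * |z₀.im| ^ β))).mono' (hmeas0 z₀)
      (Eventually.of_forall fun x => ?_)
    rw [norm_lineFourier_integrand]
    calc _ ≤ ‖f x‖ * (Real.exp (c * |z₀.im| ^ β) * Real.exp (a * ‖x‖ ^ α)) := by
          gcongr; exact exp_mul_le_of_young ha h _ _
      _ = _ := by ring
  · have := (hmeas0 z₀).mul (g := fun x : EuclideanSpace ℝ (Fin (m + 1)) =>
      -Complex.I * ((x 0 : ℝ) : ℂ)) (Continuous.aestronglyMeasurable (by fun_prop))
    refine this.congr (Eventually.of_forall fun x => ?_)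
    simp only [Pi.mul_apply]; ring
  · rw [← mul_assoc, norm_mul, norm_lineFourier_integrand]
    have hz' : |z.im| + 1 ≤ M := by
      have h1 := (Complex.abs_im_le_norm (z - z₀)).trans (mem_ball_iff_norm.1 hz).le
      rw [Complex.sub_im] at h1
      have h2 := abs_sub_abs_le_abs_sub z.im z₀.im
      simp only [M]; linarith
    have e1 : ‖-Complex.I * ((x 0 : ℝ) : ℂ)‖ = |x 0| := by simp
    have e2 : |x 0| ≤ Real.exp (x 0) + Real.exp (-x 0) := by
      have h1 := Real.add_one_le_exp (x 0)
      have h2 := Real.add_one_le_exp (-x 0)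
      have h3 := Real.exp_pos (x 0)
      have h4 := Real.exp_pos (-x 0)
      rw [abs_le]; constructor <;> linarith
    have hle : ∀ s : ℝ, |s| ≤ M →
        Real.exp (s * x 0) ≤ Real.exp (c * M ^ β) * Real.exp (a * ‖x‖ ^ α) := fun s hs => by
      have hc : 0 ≤ c := by
        have := h.pos; have := h.symm.pos
        positivity
      have := h.symm.pos
      refine (exp_mul_le_of_young ha h s x).trans ?_
      gcongr
    rw [e1]
    have hs1 := hle (z.im + 1) ((abs_add_le _ _).trans (by simpa using hz'))
    have hs2 := hle (z.im - 1) ((abs_sub _ _).trans (by simpa using hz'))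
    calc _ ≤ ‖f x‖ * Real.exp (z.im * x 0) * (Real.exp (x 0) + Real.exp (-x 0)) := by gcongr
      _ = ‖f x‖ * (Real.exp ((z.im + 1) * x 0) + Real.exp ((z.im - 1) * x 0)) := by
        rw [mul_assoc, mul_add, ← Real.exp_add, ← Real.exp_add]; ring_nf
      _ ≤ ‖f x‖ * (Real.exp (c * M ^ β) * Real.exp (a * ‖x‖ ^ α) +
            Real.exp (c * M ^ β) * Real.exp (a * ‖x‖ ^ α)) := by gcongr
      _ = _ := by ring
  · have := ((hasDerivAt_id z).const_mul (-Complex.I)).mul_const ((x 0 : ℝ) : ℂ)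
    simpa using (this.cexp).const_mul (f x * Complex.exp (-Complex.I * ((inner ℝ x y : ℝ) : ℂ)))

open Filter in
theorem continuous_fourierHat {n : ℕ} {f : EuclideanSpace ℝ (Fin n) → ℂ} (hf : Integrable f) :
    Continuous (fourierHat f) := by
  refine continuous_of_dominated (bound := fun x => ‖f x‖) (fun y => ?_) (fun y => ?_) hf.norm
    (Eventually.of_forall fun x => by fun_prop)
  · exact hf.aestronglyMeasurable.mul (Continuous.aestronglyMeasurable (by fun_prop))
  · refine Eventually.of_forall fun x => ?_
    rw [norm_mul, Complex.norm_exp]; simp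

theorem continuous_polyAbs {n : ℕ} (Q : MvPolynomial (Fin n) ℂ) : Continuous (polyAbs Q) :=
  ((MvPolynomial.continuous_eval_ofReal Q).comp
    (PiLp.continuous_ofLp 2 fun _ : Fin n => ℝ)).norm

theorem measurePreserving_toLp_cons (m : ℕ) :
    MeasurePreserving (fun p : (Fin m → ℝ) × ℝ =>
      (WithLp.toLp 2 (Fin.cons p.2 p.1) : EuclideanSpace ℝ (Fin (m + 1))))
      (volume.prod volume) volume :=
  (PiLp.volume_preserving_toLp (Fin (m + 1))).comp (measurePreserving_fin_cons m)

open Filter in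
-- Off a compact interval the polynomial is bounded below and can be divided out; on the interval
-- continuity suffices. The weight only shrinks when the norm of the point is replaced by `|t|`.
theorem integrable_line_of_lintegral_lt_top {m : ℕ} {b β δ : ℝ} (hb : 0 < b) (hβ : 0 < β)
    (hδ : 0 < δ) {Q : MvPolynomial (Fin (m + 1)) ℂ} {F : EuclideanSpace ℝ (Fin (m + 1)) → ℂ}
    (hF : Continuous F) {y : Fin m → ℝ} (hy : linePolynomial Q y ≠ 0)
    (hfin : ∫⁻ t : ℝ, ENNReal.ofReal (Real.exp (b * ‖(WithLp.toLp 2 (Fin.cons t y) :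
      EuclideanSpace ℝ (Fin (m + 1)))‖ ^ β) * ‖F (WithLp.toLp 2 (Fin.cons t y))‖ *
      polyAbs Q (WithLp.toLp 2 (Fin.cons t y)) ^ δ) < ∞) :
    Integrable fun t : ℝ => Real.exp (b * |t| ^ β) * ‖F (WithLp.toLp 2 (Fin.cons t y))‖ := by
  obtain ⟨c, hc, R, hR, hle⟩ := Polynomial.exists_forall_le_norm_eval_ofReal hy
  set T : ℝ → EuclideanSpace ℝ (Fin (m + 1)) := fun t => WithLp.toLp 2 (Fin.cons t y) with hT
  have hTc : Continuous T := by
    refine (PiLp.continuous_toLp 2 fun _ : Fin (m + 1) => ℝ).comp ?_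
    exact Continuous.finCons (by fun_prop) (by fun_prop)
  have hT0 : ∀ t, |t| ≤ ‖T t‖ := fun t => by
    simpa [hT] using norm_coord_le (T t) 0
  have hTQ : ∀ t, polyAbs Q (T t) = ‖(linePolynomial Q y).eval (t : ℂ)‖ := fun t => by
    rw [eval_linePolynomial]; rfl
  have hpow : Continuous fun t : ℝ => |t| ^ β := continuous_abs.rpow_const fun _ => Or.inr hβ.le
  have hg : Continuous fun t : ℝ => Real.exp (b * |t| ^ β) * ‖F (T t)‖ := by fun_prop
  have hpow' : Continuous fun t : ℝ => ‖T t‖ ^ β := hTc.norm.rpow_const fun _ => Or.inr hβ.le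
  have hG : Continuous fun t : ℝ =>
      Real.exp (b * ‖T t‖ ^ β) * ‖F (T t)‖ * polyAbs Q (T t) ^ δ := by
    have := ((continuous_polyAbs Q).comp hTc).rpow_const (p := δ) fun _ => Or.inr hδ.le
    exact (by fun_prop : Continuous fun t : ℝ => Real.exp (b * ‖T t‖ ^ β) * ‖F (T t)‖).mul this
  have hG0 : ∀ t, 0 ≤ Real.exp (b * ‖T t‖ ^ β) * ‖F (T t)‖ * polyAbs Q (T t) ^ δ := fun t => by
    have : 0 ≤ polyAbs Q (T t) := norm_nonneg _
    positivity
  have hGi : Integrable fun t : ℝ =>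
      Real.exp (b * ‖T t‖ ^ β) * ‖F (T t)‖ * polyAbs Q (T t) ^ δ := by
    refine ⟨hG.aestronglyMeasurable, ?_⟩
    rw [hasFiniteIntegral_iff_ofReal (Eventually.of_forall hG0)]
    exact hfin
  have h1 : Integrable (Set.indicator (Set.Icc (-R) R)
      fun t : ℝ => Real.exp (b * |t| ^ β) * ‖F (T t)‖) :=
    (hg.integrableOn_Icc).integrable_indicator measurableSet_Icc
  refine (h1.add (hGi.const_mul ((c ^ δ)⁻¹))).mono' hg.aestronglyMeasurable
    (Eventually.of_forall fun t => ?_)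
  rw [Real.norm_of_nonneg (by positivity), Pi.add_apply]
  by_cases ht : t ∈ Set.Icc (-R) R
  · rw [Set.indicator_of_mem ht]
    have := mul_nonneg (by positivity : 0 ≤ (c ^ δ)⁻¹) (hG0 t)
    linarith
  · rw [Set.indicator_of_notMem ht, zero_add, ← div_eq_inv_mul, le_div_iff₀ (by positivity)]
    have hRt : R ≤ |t| := by
      rw [Set.mem_Icc, ← abs_le] at ht
      linarith
    have := hle t hRt
    rw [← hTQ] at this
    have hh := hT0 t
    gcongr

open Filter in
theorem ae_eq_zero_of_spaceDecay_of_fourierDecay {m : ℕ} {a b α β δ : ℝ} (ha : 0 < a) (hb : 0 < b)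
    (hβ1 : 1 < β) (hβ2 : β < 2) (hαβ : α.HolderConjugate β) (hδ : 0 < δ)
    {p q : ℝ≥0∞} (hp : 1 ≤ p) (hq : 1 ≤ q)
    {Q : MvPolynomial (Fin (m + 1)) ℂ} (hQ : Q ≠ 0)
    (hab : Real.sin (Real.pi / 2 * (β - 1)) ^ (1 / β) < (a * α) ^ (1 / α) * (b * β) ^ (1 / β))
    {f : EuclideanSpace ℝ (Fin (m + 1)) → ℂ} (hfm : AEStronglyMeasurable f volume)
    (hf : SpaceDecay a α p f) (hff : FourierDecay b β δ q Q f) : f =ᵐ[volume] 0 := by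
  have hα : 0 < α := hαβ.pos
  have hβ : 0 < β := hαβ.symm.pos
  set S := Real.sin (Real.pi / 2 * (β - 1)) with hS
  have hSpos : 0 < S := by
    apply Real.sin_pos_of_pos_of_lt_pi
    · have := Real.pi_pos; have : 0 < β - 1 := by linarith
      positivity
    · nlinarith [Real.pi_pos]
  set A := (a * α) ^ (1 / α) * (b * β) ^ (1 / β) with hA
  have hApos : 0 < A := by positivity
  -- Strictness leaves room to replace `a`, `b` by `τ a`, `τ b`. As `1/α + 1/β = 1`, the product `A`
  -- is then multiplied by exactly `τ`.
  obtain ⟨τ, hτ0, hτ1, hτ⟩ : ∃ τ : ℝ, 0 < τ ∧ τ < 1 ∧ S ^ (1 / β) < τ * A := by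
    have h0 : S ^ (1 / β) / A < 1 := by rwa [div_lt_one hApos]
    obtain ⟨τ, h1, h2⟩ := exists_between h0
    exact ⟨τ, lt_trans (by positivity) h1, h2, by rwa [div_lt_iff₀ hApos] at h1⟩
  have hτA : S < (τ * a * α) ^ (β / α) * (τ * b * β) := by
    have e : τ * A = (τ * a * α) ^ (1 / α) * (τ * b * β) ^ (1 / β) := by
      rw [hA, mul_assoc τ a, mul_assoc τ b, Real.mul_rpow hτ0.le (by positivity),
        Real.mul_rpow hτ0.le (by positivity), mul_mul_mul_comm, ← Real.rpow_add hτ0]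
      have : 1 / α + 1 / β = 1 := by simpa using hαβ.inv_add_inv_eq_one
      rw [this, Real.rpow_one]
    have := Real.rpow_lt_rpow (by positivity) hτ hβ
    rwa [e, ← Real.rpow_mul hSpos.le, one_div_mul_cancel hβ.ne', Real.rpow_one,
      Real.mul_rpow (by positivity) (by positivity), ← Real.rpow_mul (by positivity),
      ← Real.rpow_mul (by positivity), one_div_mul_cancel hβ.ne', Real.rpow_one,
      one_div_mul_eq_div] at this
  have hci : (τ * a * α) ^ (-β / α) / β * S < τ * b := by
    rw [neg_div, Real.rpow_neg (by positivity), div_mul_eq_mul_div, div_lt_iff₀ hβ,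
      inv_mul_lt_iff₀ (by positivity)]
    exact hτA
  have haτ : 0 < τ * a := by positivity
  have hfI := hf.integrable hp hfm (a' := τ * a) (by nlinarith) hα
  have hfi : Integrable f := by
    refine hfI.mono' hfm (Eventually.of_forall fun x => ?_)
    refine le_mul_of_one_le_left (norm_nonneg _) (Real.one_le_exp ?_)
    positivity
  have hFc := continuous_fourierHat hfi
  obtain ⟨δ', hδ', hint⟩ := hff.exists_lintegral_lt_top hq (b' := τ * b) (by nlinarith) hβ hδ
  have hmp := measurePreserving_toLp_cons m
  have hGm : Measurable fun y : EuclideanSpace ℝ (Fin (m + 1)) => ENNReal.ofReal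
      (Real.exp (τ * b * ‖y‖ ^ β) * ‖fourierHat f y‖ * polyAbs Q y ^ δ') := by
    have h1 := (continuous_polyAbs Q).measurable
    have h2 := hFc.measurable
    fun_prop
  rw [← hmp.lintegral_comp hGm] at hint
  replace hint := (lintegral_prod _ (hGm.comp hmp.measurable).aemeasurable).symm.trans_lt hint
  have hfin := ae_lt_top (Measurable.lintegral_prod_right' (hGm.comp hmp.measurable)) hint.ne
  have hzero : ∀ᵐ y : Fin m → ℝ, ∀ t : ℝ, fourierHat f (WithLp.toLp 2 (Fin.cons t y)) = 0 := by
    filter_upwards [hfin, ae_linePolynomial_ne_zero hQ] with y hy1 hy2 t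
    have hI := integrable_line_of_lintegral_lt_top (b := τ * b) (by positivity) hβ hδ' hFc hy2 hy1
    simp only [fourierHat_cons] at hI ⊢
    exact entire_eq_zero_of_integrable_decay (differentiable_lineFourier haτ hαβ hfm hfI _)
      hβ1 hβ2 (by positivity) hci (fun z => norm_lineFourier_le haτ hαβ hfI _ z) hI t
  have hae : ∀ᵐ y, fourierHat f y = 0 := by
    have hm : MeasurableSet {y | fourierHat f y = 0} :=
      (isClosed_singleton.preimage hFc).measurableSet
    rw [← hmp.map_eq, ae_map_iff hmp.measurable.aemeasurable hm,
      Measure.ae_prod_iff_ae_ae (by exact hmp.measurable hm)]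
    filter_upwards [hzero] with y hy using Eventually.of_forall hy
  exact ae_eq_zero_of_fourierHat_eq_zero hfi fun y =>
    congrFun ((Continuous.ae_eq_iff_eq volume hFc continuous_const).1 hae) y

/-! ### The contour integral and its deformations. -/

/-- The half-opening `π / (σ + 1)` of the sector bounded by the contour of integration. -/
noncomputable def sectorAngle (σ : ℝ) : ℝ := Real.pi / (σ + 1)

theorem sectorAngle_pos {σ : ℝ} (hσ : 1 < σ) : 0 < sectorAngle σ :=
  div_pos Real.pi_pos (by linarith)

theorem sectorAngle_lt {σ : ℝ} (hσ : 1 < σ) : sectorAngle σ < Real.pi / 2 :=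
  div_lt_div_of_pos_left Real.pi_pos two_pos (by linarith)

theorem cos_nonneg_of_abs_le_sectorAngle {σ φ : ℝ} (hσ : 1 < σ) (hφ : |φ| ≤ sectorAngle σ) :
    Real.cos (sectorAngle σ) ≤ Real.cos φ := by
  rw [← Real.cos_abs φ]
  exact Real.cos_le_cos_of_nonneg_of_le_pi (abs_nonneg _)
    (by linarith [sectorAngle_lt hσ, Real.pi_pos]) hφ

theorem cos_sectorAngle_pos {σ : ℝ} (hσ : 1 < σ) : 0 < Real.cos (sectorAngle σ) :=
  Real.cos_pos_of_mem_Ioo ⟨by linarith [sectorAngle_pos hσ, Real.pi_pos], sectorAngle_lt hσ⟩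

theorem cos_mul_sectorAngle {σ : ℝ} (hσ : 1 < σ) :
    Real.cos (σ * sectorAngle σ) = -Real.cos (sectorAngle σ) := by
  have : σ * sectorAngle σ = Real.pi - sectorAngle σ := by
    rw [sectorAngle]; field_simp; ring
  rw [this, Real.cos_pi_sub]

/-- The holomorphic integrand `exp (-s e^w - t e^(-w) + (A / σ) e^(σ w) + ν w)`. -/
noncomputable def saddleKernel (σ A s t ν : ℝ) (w : ℂ) : ℂ :=
  Complex.exp (-(s : ℂ) * Complex.exp w - (t : ℂ) * Complex.exp (-w) +
    ((A / σ : ℝ) : ℂ) * Complex.exp ((σ : ℂ) * w) + (ν : ℂ) * w)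

theorem differentiable_saddleKernel (σ A s t ν : ℝ) : Differentiable ℂ (saddleKernel σ A s t ν) := by
  unfold saddleKernel; fun_prop

theorem norm_saddleKernel (σ A s t ν x φ : ℝ) :
    ‖saddleKernel σ A s t ν (x + φ * Complex.I)‖ =
      Real.exp (-s * (Real.exp x * Real.cos φ) - t * (Real.exp (-x) * Real.cos φ) +
        A / σ * (Real.exp (σ * x) * Real.cos (σ * φ)) + ν * x) := by
  have h1 : (Complex.exp (x + φ * Complex.I)).re = Real.exp x * Real.cos φ := by
    rw [Complex.exp_re]; simp
  have h2 : (Complex.exp (-(x + φ * Complex.I))).re = Real.exp (-x) * Real.cos φ := by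
    rw [Complex.exp_re]; simp
  have h3 : (Complex.exp ((σ : ℂ) * (x + φ * Complex.I))).re =
      Real.exp (σ * x) * Real.cos (σ * φ) := by
    rw [Complex.exp_re]; simp
  rw [saddleKernel, Complex.norm_exp, Complex.add_re, Complex.add_re, Complex.sub_re,
    ← Complex.ofReal_neg, Complex.re_ofReal_mul, Complex.re_ofReal_mul, Complex.re_ofReal_mul,
    Complex.re_ofReal_mul, h1, h2, h3]
  simp

/-- Horizontal translation rescales the three exponential coefficients; this is how large `s` or `t`
is reduced to a common large factor in front of a fixed phase. -/
theorem saddleKernel_add_ofReal (σ A s t ν L : ℝ) (w : ℂ) :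
    saddleKernel σ A s t ν (w + L) = (Real.exp (ν * L) : ℂ) *
      saddleKernel σ (A * Real.exp (σ * L)) (s * Real.exp L) (t * Real.exp (-L)) ν w := by
  unfold saddleKernel
  push_cast
  rw [← Complex.exp_add]
  congr 1
  rw [neg_add, mul_add, mul_add, Complex.exp_add, Complex.exp_add, Complex.exp_add]
  ring

/-- The contour `+∞ - iθ → -iθ → iθ → +∞ + iθ`, parametrized by arc length. -/
noncomputable def keyhole (θ u : ℝ) : ℂ :=
  ((max (|u| - θ) 0 : ℝ) : ℂ) + ((max (-θ) (min u θ) : ℝ) : ℂ) * Complex.I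

/-- The derivative of `keyhole`. -/
noncomputable def keyholeDir (θ u : ℝ) : ℂ := if u ≤ -θ then -1 else if u ≤ θ then Complex.I else 1

theorem continuous_keyhole (θ : ℝ) : Continuous (keyhole θ) := by
  unfold keyhole; fun_prop

theorem measurable_keyholeDir (θ : ℝ) : Measurable (keyholeDir θ) := by
  unfold keyholeDir
  exact Measurable.ite measurableSet_Iic measurable_const
    (Measurable.ite measurableSet_Iic measurable_const measurable_const)

theorem norm_keyholeDir (θ u : ℝ) : ‖keyholeDir θ u‖ = 1 := by
  unfold keyholeDir; split_ifs <;> simp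

theorem keyhole_of_le_neg {θ u : ℝ} (hθ : 0 ≤ θ) (hu : u ≤ -θ) :
    keyhole θ u = ((-u - θ : ℝ) : ℂ) + ((-θ : ℝ) : ℂ) * Complex.I := by
  rw [keyhole, abs_of_nonpos (by linarith), max_eq_left (by linarith),
    min_eq_left (by linarith), max_eq_left (by linarith)]

theorem keyhole_of_mem {θ u : ℝ} (hu1 : -θ ≤ u) (hu2 : u ≤ θ) :
    keyhole θ u = ((0 : ℝ) : ℂ) + (u : ℂ) * Complex.I := by
  rw [keyhole, max_eq_right (by linarith [abs_le.2 ⟨hu1, hu2⟩]), min_eq_left hu2,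
    max_eq_right hu1]

theorem keyhole_of_le {θ u : ℝ} (hθ : 0 ≤ θ) (hu : θ ≤ u) :
    keyhole θ u = ((u - θ : ℝ) : ℂ) + (θ : ℂ) * Complex.I := by
  rw [keyhole, abs_of_nonneg (by linarith), max_eq_left (by linarith),
    min_eq_right (by linarith), max_eq_right (by linarith)]

theorem integrable_exp_neg_abs : Integrable fun u : ℝ => Real.exp (-|u|) := by
  rw [← integrableOn_univ, ← Set.Iic_union_Ioi (a := (0 : ℝ)), integrableOn_union]
  constructor
  · refine (integrableOn_exp_mul_Iic one_pos 0).congr_fun (fun u hu => ?_) measurableSet_Iic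
    simp [abs_of_nonpos (Set.mem_Iic.1 hu)]
  · refine (integrableOn_exp_mul_Ioi (by norm_num : (-1 : ℝ) < 0) 0).congr_fun (fun u hu => ?_)
      measurableSet_Ioi
    simp [abs_of_pos (Set.mem_Ioi.1 hu)]

theorem exists_mul_sub_exp_le {σ k : ℝ} (hσ : 0 < σ) (hk : 0 < k) (ν : ℝ) :
    ∃ C : ℝ, ∀ x : ℝ, 0 ≤ x → ν * x - k * Real.exp (σ * x) ≤ C - x := by
  -- Obtained by bounding `exp (σ x)` below by `(σ x)² / 2` and completing the square.
  refine ⟨(ν + 1) ^ 2 / (2 * (k * σ ^ 2)), fun x hx => ?_⟩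
  have h := Real.quadratic_le_exp_of_nonneg (mul_nonneg hσ.le hx)
  have h2 : k * ((σ * x) ^ 2 / 2) ≤ k * Real.exp (σ * x) := by
    gcongr; nlinarith [mul_nonneg hσ.le hx]
  have hm : 0 < k * σ ^ 2 := by positivity
  have h3 : (ν + 1) * x ≤ (ν + 1) ^ 2 / (2 * (k * σ ^ 2)) + k * ((σ * x) ^ 2 / 2) := by
    rw [← sub_nonneg]
    have : (ν + 1) ^ 2 / (2 * (k * σ ^ 2)) + k * ((σ * x) ^ 2 / 2) - (ν + 1) * x =
      ((ν + 1) - k * σ ^ 2 * x) ^ 2 / (2 * (k * σ ^ 2)) := by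
      field_simp; ring
    rw [this]; positivity
  linarith

theorem norm_saddleKernel_ray {σ φ : ℝ} (hσ : 1 < σ) (hφ : |φ| = sectorAngle σ)
    (A s t ν x : ℝ) : ‖saddleKernel σ A s t ν (x + φ * Complex.I)‖ =
      Real.exp (ν * x - Real.cos (sectorAngle σ) *
        (s * Real.exp x + t * Real.exp (-x) + A / σ * Real.exp (σ * x))) := by
  have h1 : Real.cos φ = Real.cos (sectorAngle σ) := by rw [← Real.cos_abs, hφ]
  have h2 : Real.cos (σ * φ) = -Real.cos (sectorAngle σ) := by
    rw [← Real.cos_abs, abs_mul, hφ, abs_of_pos (by linarith), cos_mul_sectorAngle hσ]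
  rw [norm_saddleKernel, h1, h2]
  congr 1; ring

/-- Along the contour `Re e^w` and `Re e^(-w)` are positive, so the terms in `s` and `t` only help.
On the rays `Re e^(σw)` is negative, and this alone gives convergence, uniformly in `s` and `t`. -/
theorem exists_norm_saddleKernel_keyhole_le {σ A : ℝ} (hσ : 1 < σ) (hA : 0 < A) (ν : ℝ) :
    ∃ C : ℝ, ∀ s t u : ℝ, 0 ≤ s → 0 ≤ t →
      ‖saddleKernel σ A s t ν (keyhole (sectorAngle σ) u)‖ ≤ C * Real.exp (-|u|) := by
  set θ := sectorAngle σ with hθ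
  have hθ0 := sectorAngle_pos hσ
  have hS := cos_sectorAngle_pos hσ
  rw [← hθ] at hS hθ0
  have hk : 0 < Real.cos θ * (A / σ) := by
    have : 0 < σ := by linarith
    positivity
  obtain ⟨C, hC⟩ := exists_mul_sub_exp_le (by linarith : 0 < σ) hk ν
  refine ⟨Real.exp (|C| + A / σ + θ), fun s t u hs ht => ?_⟩
  rw [← Real.exp_add]
  have hAσ : 0 < A / σ := div_pos hA (by linarith)
  have hray : ∀ x φ : ℝ, 0 ≤ x → |φ| = θ →
      ‖saddleKernel σ A s t ν (x + φ * Complex.I)‖ ≤ Real.exp (|C| + A / σ + θ + -(x + θ)) := by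
    intro x φ hx hφ
    rw [norm_saddleKernel_ray hσ hφ, Real.exp_le_exp]
    have h1 := hC x hx
    have h2 : 0 ≤ Real.cos θ * (s * Real.exp x + t * Real.exp (-x)) := by positivity
    have h3 := le_abs_self C
    rw [← hθ]
    linarith
  rcases le_or_gt u (-θ) with h | h
  · rw [keyhole_of_le_neg hθ0.le h]
    convert hray (-u - θ) (-θ) (by linarith) (by rw [abs_neg, abs_of_pos hθ0]) using 2
    have hu : |u| = -u := abs_of_neg (by linarith)
    rw [hu]; ring
  rcases le_or_gt u θ with h' | h'
  · rw [keyhole_of_mem h.le h', norm_saddleKernel, Real.exp_le_exp]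
    have hu : |u| ≤ θ := abs_le.2 ⟨h.le, h'⟩
    have hc := hS.le.trans (cos_nonneg_of_abs_le_sectorAngle hσ (hθ ▸ hu))
    have h1 : 0 ≤ s * (Real.exp 0 * Real.cos u) := by positivity
    have h2 : 0 ≤ t * (Real.exp (-0) * Real.cos u) := by positivity
    have h3 : A / σ * (Real.exp (σ * 0) * Real.cos (σ * u)) ≤ A / σ := by
      rw [mul_zero, Real.exp_zero, one_mul]
      exact mul_le_of_le_one_right hAσ.le (Real.cos_le_one _)
    have h4 := abs_nonneg C
    simp only [neg_zero, mul_zero, Real.exp_zero, one_mul, neg_mul, add_zero] at h1 h2 h3 ⊢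
    linarith
  · rw [keyhole_of_le hθ0.le h'.le]
    convert hray (u - θ) θ (by linarith) (abs_of_pos hθ0) using 2
    have hu : |u| = u := abs_of_pos (by linarith)
    rw [hu]; ring

/-- The contour integral of the saddle-point kernel. -/
noncomputable def saddleIntegral (σ A s t ν : ℝ) : ℂ :=
  ∫ u, keyholeDir (sectorAngle σ) u * saddleKernel σ A s t ν (keyhole (sectorAngle σ) u)

theorem integrable_saddle {σ A : ℝ} (hσ : 1 < σ) (hA : 0 < A) (ν : ℝ) {s t : ℝ}
    (hs : 0 ≤ s) (ht : 0 ≤ t) : Integrable fun u =>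
      keyholeDir (sectorAngle σ) u * saddleKernel σ A s t ν (keyhole (sectorAngle σ) u) := by
  obtain ⟨C, hC⟩ := exists_norm_saddleKernel_keyhole_le hσ hA ν
  refine (integrable_exp_neg_abs.const_mul C).mono' ?_ (Filter.Eventually.of_forall fun u => ?_)
  · exact (measurable_keyholeDir _).aestronglyMeasurable.mul
      ((differentiable_saddleKernel σ A s t ν).continuous.comp
        (continuous_keyhole _)).aestronglyMeasurable
  · rw [norm_mul, norm_keyholeDir, one_mul]
    exact hC s t u hs ht

theorem integrableOn_saddle_ray {σ A φ : ℝ} (hσ : 1 < σ) (hA : 0 < A) (ν : ℝ) {s t : ℝ}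
    (hs : 0 ≤ s) (ht : 0 ≤ t) (hφ : |φ| = sectorAngle σ) (L : ℝ) :
    IntegrableOn (fun x : ℝ => saddleKernel σ A s t ν (x + φ * Complex.I)) (Set.Ioi L) := by
  have hcont : Continuous fun x : ℝ => saddleKernel σ A s t ν (x + φ * Complex.I) :=
    (differentiable_saddleKernel σ A s t ν).continuous.comp (by fun_prop)
  have hk : 0 < Real.cos (sectorAngle σ) * (A / σ) :=
    mul_pos (cos_sectorAngle_pos hσ) (div_pos hA (by linarith))
  obtain ⟨C, hC⟩ := exists_mul_sub_exp_le (by linarith : 0 < σ) hk ν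
  have h0 : IntegrableOn (fun x : ℝ => saddleKernel σ A s t ν (x + φ * Complex.I)) (Set.Ioi 0) := by
    refine Integrable.mono' (((integrableOn_exp_mul_Ioi (by norm_num : (-1 : ℝ) < 0) 0)).const_mul
      (Real.exp C)) hcont.aestronglyMeasurable
      ((ae_restrict_iff' measurableSet_Ioi).2 (Filter.Eventually.of_forall fun x hx => ?_))
    rw [norm_saddleKernel_ray hσ hφ, ← Real.exp_add, Real.exp_le_exp]
    have h1 := hC x (le_of_lt hx)
    have h2 : 0 ≤ Real.cos (sectorAngle σ) * (s * Real.exp x + t * Real.exp (-x)) := by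
      have := cos_sectorAngle_pos hσ
      positivity
    linarith
  rcases le_total L 0 with h | h
  · rw [← Set.Ioc_union_Ioi_eq_Ioi h]
    exact (hcont.integrableOn_Icc.mono_set Set.Ioc_subset_Icc_self).union h0
  · exact h0.mono_set (Set.Ioi_subset_Ioi h)

theorem setIntegral_Ioi_comp_add (f : ℝ → ℂ) (a c : ℝ) :
    ∫ x in Set.Ioi a, f (x + c) = ∫ x in Set.Ioi (a + c), f x := by
  have h := (measurePreserving_add_right volume c).setIntegral_preimage_emb
    (measurableEmbedding_addRight c) f (Set.Ioi (a + c))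
  rw [← h]
  congr 2
  ext x; simp

theorem saddleIntegral_eq_sum {σ A : ℝ} (hσ : 1 < σ) (hA : 0 < A) (ν : ℝ) {s t : ℝ}
    (hs : 0 ≤ s) (ht : 0 ≤ t) :
    saddleIntegral σ A s t ν =
      Complex.I * (∫ y in (-sectorAngle σ)..(sectorAngle σ),
        saddleKernel σ A s t ν (((0 : ℝ) : ℂ) + y * Complex.I)) +
      (∫ x in Set.Ioi (0 : ℝ), saddleKernel σ A s t ν (x + (sectorAngle σ : ℝ) * Complex.I)) -
      ∫ x in Set.Ioi (0 : ℝ), saddleKernel σ A s t ν (x + (-sectorAngle σ : ℝ) * Complex.I) := by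
  have hI := integrable_saddle hσ hA ν hs ht
  have hθ0 := sectorAngle_pos hσ
  rw [saddleIntegral]
  set θ := sectorAngle σ with hθ
  set K := saddleKernel σ A s t ν
  rw [← intervalIntegral.integral_Iic_add_Ioi (b := -θ) hI.integrableOn hI.integrableOn,
    ← Set.Ioc_union_Ioi_eq_Ioi (by linarith : -θ ≤ θ),
    setIntegral_union (Set.Ioc_disjoint_Ioi le_rfl) measurableSet_Ioi hI.integrableOn
      hI.integrableOn]
  have h1 : ∫ u in Set.Iic (-θ), keyholeDir θ u * K (keyhole θ u) =
      -∫ x in Set.Ioi (0 : ℝ), K (x + (-θ : ℝ) * Complex.I) := by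
    have e1 := integral_comp_neg_Iic (-θ) fun x : ℝ => -K (((x - θ : ℝ) : ℂ) + (-θ : ℝ) * Complex.I)
    have e2 := setIntegral_Ioi_comp_add
      (fun x : ℝ => K (((x - θ : ℝ) : ℂ) + (-θ : ℝ) * Complex.I)) 0 θ
    simp only [add_sub_cancel_right, zero_add] at e2
    rw [neg_neg] at e1
    rw [e2, ← integral_neg, ← e1]
    refine setIntegral_congr_fun measurableSet_Iic fun u hu => ?_
    simp only [keyholeDir, if_pos (Set.mem_Iic.1 hu), keyhole_of_le_neg hθ0.le hu, neg_one_mul]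
  have h2 : ∫ u in Set.Ioc (-θ) θ, keyholeDir θ u * K (keyhole θ u) =
      Complex.I * ∫ y in (-θ)..θ, K (((0 : ℝ) : ℂ) + y * Complex.I) := by
    rw [intervalIntegral.integral_of_le (by linarith), ← integral_const_mul]
    refine setIntegral_congr_fun measurableSet_Ioc fun u hu => ?_
    simp only [keyholeDir, if_neg (not_le.2 hu.1), if_pos hu.2, keyhole_of_mem hu.1.le hu.2]
  have h3 : ∫ u in Set.Ioi θ, keyholeDir θ u * K (keyhole θ u) =
      ∫ x in Set.Ioi (0 : ℝ), K (x + (θ : ℝ) * Complex.I) := by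
    have e2 := setIntegral_Ioi_comp_add
      (fun x : ℝ => K (((x - θ : ℝ) : ℂ) + (θ : ℝ) * Complex.I)) 0 θ
    simp only [add_sub_cancel_right, zero_add] at e2
    rw [e2]
    refine setIntegral_congr_fun measurableSet_Ioi fun u hu => ?_
    have hu' : θ < u := hu
    simp only [keyholeDir, if_neg (not_le.2 (by linarith : -θ < u)), if_neg (not_le.2 hu'),
      keyhole_of_le hθ0.le hu'.le, one_mul]
  rw [h1, h2, h3]; ring

/-- The contour may be translated horizontally. -/
theorem saddleIntegral_eq_shifted {σ A : ℝ} (hσ : 1 < σ) (hA : 0 < A) (ν : ℝ) {s t : ℝ}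
    (hs : 0 ≤ s) (ht : 0 ≤ t) (L : ℝ) :
    saddleIntegral σ A s t ν =
      Complex.I * (∫ y in (-sectorAngle σ)..(sectorAngle σ),
        saddleKernel σ A s t ν ((L : ℂ) + y * Complex.I)) +
      (∫ x in Set.Ioi L, saddleKernel σ A s t ν (x + (sectorAngle σ : ℝ) * Complex.I)) -
      ∫ x in Set.Ioi L, saddleKernel σ A s t ν (x + (-sectorAngle σ : ℝ) * Complex.I) := by
  have hθ0 := sectorAngle_pos hσ
  rw [saddleIntegral_eq_sum hσ hA ν hs ht]
  have hp : |sectorAngle σ| = sectorAngle σ := abs_of_pos hθ0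
  have hm : |-sectorAngle σ| = sectorAngle σ := by rw [abs_neg, hp]
  rw [← intervalIntegral.integral_interval_add_Ioi (b := L)
    (integrableOn_saddle_ray hσ hA ν hs ht hp 0) (integrableOn_saddle_ray hσ hA ν hs ht hp L),
    ← intervalIntegral.integral_interval_add_Ioi (b := L)
    (integrableOn_saddle_ray hσ hA ν hs ht hm 0) (integrableOn_saddle_ray hσ hA ν hs ht hm L)]
  have hrect := Complex.integral_boundary_rect_eq_zero_of_differentiableOn
    (saddleKernel σ A s t ν) ⟨0, -sectorAngle σ⟩ ⟨L, sectorAngle σ⟩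
    (differentiable_saddleKernel σ A s t ν).differentiableOn
  simp only [smul_eq_mul] at hrect
  linear_combination -hrect

theorem saddleIntegral_shift {σ A : ℝ} (hσ : 1 < σ) (hA : 0 < A) (ν : ℝ) {s t : ℝ}
    (hs : 0 ≤ s) (ht : 0 ≤ t) (L : ℝ) :
    saddleIntegral σ A s t ν = (Real.exp (ν * L) : ℂ) * saddleIntegral σ (A * Real.exp (σ * L))
      (s * Real.exp L) (t * Real.exp (-L)) ν := by
  rw [saddleIntegral_eq_shifted hσ hA ν hs ht L,
    saddleIntegral_eq_sum hσ (by positivity) ν (by positivity) (by positivity)]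
  have e : ∀ y : ℝ, ∫ x in Set.Ioi L, saddleKernel σ A s t ν (x + y * Complex.I) =
    ∫ x in Set.Ioi (0 : ℝ), (Real.exp (ν * L) : ℂ) * saddleKernel σ (A * Real.exp (σ * L))
      (s * Real.exp L) (t * Real.exp (-L)) ν (x + y * Complex.I) := fun y => by
    have := setIntegral_Ioi_comp_add (fun x : ℝ => saddleKernel σ A s t ν (x + y * Complex.I)) 0 L
    rw [zero_add] at this
    rw [← this]
    congr 1; ext x
    rw [← saddleKernel_add_ofReal]; push_cast; ring_nf
  have e0 : ∀ y : ℝ, saddleKernel σ A s t ν ((L : ℂ) + y * Complex.I) =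
      (Real.exp (ν * L) : ℂ) * saddleKernel σ (A * Real.exp (σ * L))
      (s * Real.exp L) (t * Real.exp (-L)) ν (((0 : ℝ) : ℂ) + y * Complex.I) := fun y => by
    rw [← saddleKernel_add_ofReal]; push_cast; ring_nf
  simp only [e, e0, integral_const_mul, intervalIntegral.integral_const_mul]
  ring

/-- The contour can be pushed to `Re w → -∞` only if the integrand decays there, through `t e^(-x)`
or through `ν x`. -/
theorem exists_left_exponent_bound {k t ν : ℝ} (hk : 0 < k) (ht : 0 ≤ t) (h : 0 < t ∨ 0 < ν) :
    ∃ C ε : ℝ, 0 < ε ∧ ∀ x : ℝ, x ≤ 0 → ν * x - k * (t * Real.exp (-x)) ≤ C + ε * x := by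
  rcases h with h | h
  · obtain ⟨C, hC⟩ := exists_mul_sub_exp_le one_pos (mul_pos hk h) (-ν)
    refine ⟨C, 1, one_pos, fun x hx => ?_⟩
    have := hC (-x) (by linarith)
    rw [one_mul] at this
    linarith
  · refine ⟨0, ν, h, fun x _ => ?_⟩
    have : 0 ≤ k * (t * Real.exp (-x)) := by positivity
    linarith

theorem integrable_saddle_ray {σ A φ : ℝ} (hσ : 1 < σ) (hA : 0 < A) {ν s t : ℝ}
    (hs : 0 ≤ s) (ht : 0 ≤ t) (h : 0 < t ∨ 0 < ν) (hφ : |φ| = sectorAngle σ) :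
    Integrable fun x : ℝ => saddleKernel σ A s t ν (x + φ * Complex.I) := by
  have hcont : Continuous fun x : ℝ => saddleKernel σ A s t ν (x + φ * Complex.I) :=
    (differentiable_saddleKernel σ A s t ν).continuous.comp (by fun_prop)
  have hS := cos_sectorAngle_pos hσ
  have hAσ : 0 < A / σ := div_pos hA (by linarith)
  obtain ⟨C, ε, hε, hC⟩ := exists_left_exponent_bound hS ht h
  rw [← integrableOn_univ, ← Set.Iic_union_Ioi (a := (0 : ℝ)), integrableOn_union]
  refine ⟨?_, integrableOn_saddle_ray hσ hA ν hs ht hφ 0⟩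
  refine Integrable.mono' (((integrableOn_exp_mul_Iic hε 0)).const_mul
      (Real.exp C)) hcont.aestronglyMeasurable
      ((ae_restrict_iff' measurableSet_Iic).2 (Filter.Eventually.of_forall fun x hx => ?_))
  rw [norm_saddleKernel_ray hσ hφ, ← Real.exp_add, Real.exp_le_exp]
  have h1 := hC x hx
  have h2 : 0 ≤ Real.cos (sectorAngle σ) * (s * Real.exp x + A / σ * Real.exp (σ * x)) := by
    positivity
  linarith

open Filter Topology in
theorem tendsto_saddle_segment {σ A : ℝ} (hσ : 1 < σ) (hA : 0 < A) {ν s t : ℝ}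
    (hs : 0 ≤ s) (ht : 0 ≤ t) (h : 0 < t ∨ 0 < ν) :
    Tendsto (fun L : ℝ => ∫ y in (-sectorAngle σ)..(sectorAngle σ),
      saddleKernel σ A s t ν ((L : ℂ) + y * Complex.I)) atBot (𝓝 0) := by
  have hS := cos_sectorAngle_pos hσ
  have hθ0 := sectorAngle_pos hσ
  have hAσ : 0 < A / σ := div_pos hA (by linarith)
  obtain ⟨C, ε, hε, hC⟩ := exists_left_exponent_bound hS ht h
  have hlim : Tendsto (fun L : ℝ => Real.exp (C + A / σ + ε * L) *
      |sectorAngle σ - -sectorAngle σ|) atBot (𝓝 0) := by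
    rw [← zero_mul |sectorAngle σ - -sectorAngle σ|]
    refine Tendsto.mul_const _ (Real.tendsto_exp_atBot.comp ?_)
    exact tendsto_atBot_add_const_left _ _ (tendsto_id.const_mul_atBot hε)
  refine squeeze_zero_norm' ?_ hlim
  filter_upwards [eventually_le_atBot 0] with L hL
  refine intervalIntegral.norm_integral_le_of_norm_le_const fun y hy => ?_
  rw [Set.uIoc_of_le (by linarith)] at hy
  rw [norm_saddleKernel, Real.exp_le_exp]
  have hc := cos_nonneg_of_abs_le_sectorAngle hσ (abs_le.2 ⟨hy.1.le, hy.2⟩)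
  have h1 : 0 ≤ s * (Real.exp L * Real.cos y) := by have := hS.le.trans hc; positivity
  have h2 : Real.cos (sectorAngle σ) * (t * Real.exp (-L)) ≤ t * (Real.exp (-L) * Real.cos y) := by
    rw [mul_left_comm, mul_comm (Real.cos _)]; gcongr
  have h3 : A / σ * (Real.exp (σ * L) * Real.cos (σ * y)) ≤ A / σ := by
    refine mul_le_of_le_one_right hAσ.le ?_
    have : Real.exp (σ * L) ≤ 1 := by
      rw [Real.exp_le_one_iff]; nlinarith
    calc _ ≤ Real.exp (σ * L) * 1 := by gcongr; exact Real.cos_le_one _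
      _ ≤ 1 := by linarith
  have h4 := hC L hL
  linarith

open Filter Topology in
/-- The contour may be opened to the two full rays bounding the sector. -/
theorem saddleIntegral_eq_rays {σ A : ℝ} (hσ : 1 < σ) (hA : 0 < A) {ν s t : ℝ}
    (hs : 0 ≤ s) (ht : 0 ≤ t) (h : 0 < t ∨ 0 < ν) :
    saddleIntegral σ A s t ν =
      (∫ x : ℝ, saddleKernel σ A s t ν (x + (sectorAngle σ : ℝ) * Complex.I)) -
      ∫ x : ℝ, saddleKernel σ A s t ν (x + (-sectorAngle σ : ℝ) * Complex.I) := by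
  have hp : |sectorAngle σ| = sectorAngle σ := abs_of_pos (sectorAngle_pos hσ)
  have hm : |-sectorAngle σ| = sectorAngle σ := by rw [abs_neg, hp]
  have hcov := aecover_Ioi (μ := (volume : Measure ℝ)) (tendsto_id (x := (atBot : Filter ℝ)))
  have h1 := hcov.integral_tendsto_of_countably_generated
    (integrable_saddle_ray hσ hA hs ht h hp)
  have h2 := hcov.integral_tendsto_of_countably_generated
    (integrable_saddle_ray hσ hA hs ht h hm)
  have h3 := (((tendsto_saddle_segment hσ hA hs ht h).const_mul Complex.I).add h1).sub h2
  rw [mul_zero, zero_add] at h3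
  refine tendsto_nhds_unique (tendsto_const_nhds.congr fun L => ?_) h3
  exact saddleIntegral_eq_shifted hσ hA ν hs ht L

/-! ### Saddle-point estimates in space and frequency. -/

/-- For `0 ≤ φ ≤ π / (σ + 1)` one has `φ ≤ σφ ≤ π - φ`, so the derivative `sin φ - sin (σφ)` is
nonpositive and the maximum sits at `φ = 0`. -/
theorem cos_sub_cos_mul_div_le {σ φ : ℝ} (hσ : 1 < σ) (hφ : |φ| ≤ sectorAngle σ) :
    -Real.cos φ + Real.cos (σ * φ) / σ ≤ -(1 - 1 / σ) := by
  have hσ0 : 0 < σ := by linarith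
  have hanti : AntitoneOn (fun x : ℝ => -Real.cos x + Real.cos (σ * x) / σ)
      (Set.Icc 0 (sectorAngle σ)) := by
    refine antitoneOn_of_hasDerivWithinAt_nonpos (convex_Icc _ _) (by fun_prop)
      (f' := fun x => Real.sin x - Real.sin (σ * x)) (fun x _ => ?_) fun x hx => ?_
    · have h1 := (Real.hasDerivAt_cos x).neg
      have h2 := (((hasDerivAt_id x).const_mul σ).cos).div_const σ
      refine HasDerivAt.hasDerivWithinAt ?_
      convert! h1.add h2 using 1
      simp; field_simp; ring
    · rw [interior_Icc] at hx
      have hx1 : σ * x ≤ Real.pi - x := by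
        have := hx.2
        rw [sectorAngle, lt_div_iff₀ (by linarith)] at this
        linarith
      have hx2 := sectorAngle_lt hσ
      have hx3 : x ≤ σ * x := by nlinarith [hx.1]
      rw [sub_nonpos]
      rcases le_total (σ * x) (Real.pi / 2) with h | h
      · exact Real.sin_le_sin_of_le_of_le_pi_div_two (by linarith [hx.1]) h hx3
      · rw [← Real.sin_pi_sub (σ * x)]
        exact Real.sin_le_sin_of_le_of_le_pi_div_two (by linarith [hx.1]) (by linarith)
          (by linarith)
  have := hanti (Set.left_mem_Icc.2 (sectorAngle_pos hσ).le) ⟨abs_nonneg φ, hφ⟩ (abs_nonneg φ)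
  simp only [mul_zero, Real.cos_zero, Real.cos_abs] at this
  have e : Real.cos (σ * |φ|) = Real.cos (σ * φ) := by
    rw [← Real.cos_abs (σ * φ), abs_mul, abs_of_pos hσ0]
  rw [e] at this
  linarith

/-- On the whole contour the real part of the phase is maximal at the saddle point `w = 0`. -/
theorem norm_saddleKernel_keyhole_le {σ Λ : ℝ} (hσ : 1 < σ) (hΛ : 1 ≤ Λ) (ν u : ℝ) :
    ‖saddleKernel σ Λ Λ 0 ν (keyhole (sectorAngle σ) u)‖ ≤ Real.exp (-(1 - 1 / σ) * (Λ - 1)) *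
      ‖saddleKernel σ 1 1 0 ν (keyhole (sectorAngle σ) u)‖ := by
  have hσ0 : 0 < σ := by linarith
  have hθ0 := sectorAngle_pos hσ
  have hS := cos_sectorAngle_pos hσ
  have key : ∀ x φ : ℝ, -(Real.exp x * Real.cos φ) + Real.exp (σ * x) * Real.cos (σ * φ) / σ ≤
      -(1 - 1 / σ) → ‖saddleKernel σ Λ Λ 0 ν (x + φ * Complex.I)‖ ≤
        Real.exp (-(1 - 1 / σ) * (Λ - 1)) * ‖saddleKernel σ 1 1 0 ν (x + φ * Complex.I)‖ := by
    intro x φ h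
    rw [norm_saddleKernel, norm_saddleKernel, ← Real.exp_add, Real.exp_le_exp]
    -- Only `Λ - 1` copies of the phase are estimated; the remaining one keeps the integral
    -- convergent.
    have := mul_le_mul_of_nonneg_left h (sub_nonneg.2 hΛ)
    have e1 : Λ / σ * (Real.exp (σ * x) * Real.cos (σ * φ)) =
      Λ * (Real.exp (σ * x) * Real.cos (σ * φ) / σ) := by ring
    have e2 : 1 / σ * (Real.exp (σ * x) * Real.cos (σ * φ)) =
      Real.exp (σ * x) * Real.cos (σ * φ) / σ := by ring
    rw [e1, e2]
    linarith
  have hray : ∀ x φ : ℝ, 0 ≤ x → |φ| = sectorAngle σ →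
      -(Real.exp x * Real.cos φ) + Real.exp (σ * x) * Real.cos (σ * φ) / σ ≤ -(1 - 1 / σ) := by
    intro x φ hx hφ
    have h0 := cos_sub_cos_mul_div_le hσ hφ.le
    have h1 : Real.cos φ = Real.cos (sectorAngle σ) := by rw [← Real.cos_abs, hφ]
    have h2 : Real.cos (σ * φ) = -Real.cos (sectorAngle σ) := by
      rw [← Real.cos_abs, abs_mul, hφ, abs_of_pos (by linarith), cos_mul_sectorAngle hσ]
    rw [h1, h2] at h0 ⊢
    refine le_trans ?_ h0
    have h3 : Real.cos (sectorAngle σ) ≤ Real.exp x * Real.cos (sectorAngle σ) :=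
      le_mul_of_one_le_left hS.le (Real.one_le_exp hx)
    have h4 : Real.cos (sectorAngle σ) / σ ≤ Real.exp (σ * x) * Real.cos (sectorAngle σ) / σ := by
      gcongr
      exact le_mul_of_one_le_left hS.le (Real.one_le_exp (by positivity))
    rw [mul_neg, neg_div, neg_div]
    linarith
  rcases le_or_gt u (-sectorAngle σ) with h | h
  · rw [keyhole_of_le_neg hθ0.le h]
    exact key _ _ (hray _ _ (by linarith) (by rw [abs_neg, abs_of_pos hθ0]))
  rcases le_or_gt u (sectorAngle σ) with h' | h'
  · rw [keyhole_of_mem h.le h']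
    refine key _ _ ?_
    have := cos_sub_cos_mul_div_le hσ (abs_le.2 ⟨h.le, h'⟩)
    simpa using this
  · rw [keyhole_of_le hθ0.le h'.le]
    exact key _ _ (hray _ _ (by linarith) (abs_of_pos hθ0))

theorem exists_norm_saddleIntegral_le {σ A : ℝ} (hσ : 1 < σ) (hA : 0 < A) (ν : ℝ) :
    ∃ C : ℝ, ∀ s t : ℝ, 0 ≤ s → 0 ≤ t → ‖saddleIntegral σ A s t ν‖ ≤ C := by
  obtain ⟨C, hC⟩ := exists_norm_saddleKernel_keyhole_le hσ hA ν
  refine ⟨∫ u : ℝ, C * Real.exp (-|u|), fun s t hs ht => ?_⟩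
  refine norm_integral_le_of_norm_le (integrable_exp_neg_abs.const_mul C)
    (Filter.Eventually.of_forall fun u => ?_)
  rw [norm_mul, norm_keyholeDir, one_mul]
  exact hC s t u hs ht

theorem exists_norm_le_of_bounded_of_decay {G : ℝ → ℂ} {B C k κ N M : ℝ} (hN : 0 ≤ N) (hk : 0 ≤ k)
    (hκ : 0 ≤ κ) (hM : M ≤ -N)
    (hB : ∀ s, 0 ≤ s → ‖G s‖ ≤ B)
    (hC : ∀ s, 1 ≤ s → ‖G s‖ ≤ C * s ^ M * Real.exp (-k * s ^ κ)) :
    ∃ D : ℝ, ∀ s, 0 ≤ s → ‖G s‖ ≤ D * (1 + s) ^ (-N) * Real.exp (-k * s ^ κ) := by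
  have hB0 : 0 ≤ B := (norm_nonneg _).trans (hB 0 le_rfl)
  have hpos : ∀ s : ℝ, 0 ≤ s → 0 < 1 + s := fun s hs => by linarith
  refine ⟨(|C| + B * Real.exp k) * 2 ^ N, fun s hs => ?_⟩
  have h1s := hpos s hs
  rcases le_total 1 s with h | h
  · have hs0 : 0 < s := by linarith
    have e1 : s ^ M ≤ 2 ^ N * (1 + s) ^ (-N) := by
      calc s ^ M ≤ s ^ (-N) := Real.rpow_le_rpow_of_exponent_le h hM
        _ ≤ ((1 + s) / 2) ^ (-N) :=
          Real.rpow_le_rpow_of_nonpos (by linarith) (by linarith) (by linarith)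
        _ = 2 ^ N * (1 + s) ^ (-N) := by
          rw [Real.div_rpow h1s.le two_pos.le, Real.rpow_neg two_pos.le, div_inv_eq_mul, mul_comm]
    calc ‖G s‖ ≤ C * s ^ M * Real.exp (-k * s ^ κ) := hC s h
      _ ≤ |C| * (2 ^ N * (1 + s) ^ (-N)) * Real.exp (-k * s ^ κ) := by
        gcongr; exact le_abs_self C
      _ ≤ (|C| + B * Real.exp k) * (2 ^ N * (1 + s) ^ (-N)) * Real.exp (-k * s ^ κ) := by
        gcongr
        have : 0 ≤ B * Real.exp k := by positivity
        linarith
      _ = _ := by ring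
  · have e1 : 1 ≤ 2 ^ N * (1 + s) ^ (-N) := by
      rw [Real.rpow_neg h1s.le, ← div_eq_mul_inv, ← Real.div_rpow two_pos.le h1s.le]
      exact Real.one_le_rpow (by rw [le_div_iff₀ h1s]; linarith) hN
    have e2 : 1 ≤ Real.exp k * Real.exp (-k * s ^ κ) := by
      rw [← Real.exp_add]
      apply Real.one_le_exp
      have := mul_le_of_le_one_right hk (Real.rpow_le_one hs h hκ)
      linarith
    calc ‖G s‖ ≤ B * 1 * 1 := by simpa using hB s hs
      _ ≤ B * (2 ^ N * (1 + s) ^ (-N)) * (Real.exp k * Real.exp (-k * s ^ κ)) := by gcongr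
      _ ≤ (B * Real.exp k + |C|) * (2 ^ N * (1 + s) ^ (-N)) * Real.exp (-k * s ^ κ) := by
        have : 0 ≤ |C| * (2 ^ N * (1 + s) ^ (-N)) * Real.exp (-k * s ^ κ) := by positivity
        linarith
      _ = _ := by ring

/-- After translation the phase is `Λ (-e^w + e^(σw) / σ)`, whose real part on the contour peaks at
`w = 0` with value `-Λ (1 - 1/σ)`. The prefactor `e^(νL)` is a power of `s`, which `ν` makes as
small as wanted. -/
theorem saddleIntegral_space_decay {σ N ν : ℝ} (hσ : 1 < σ) (hN : 0 ≤ N)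
    (hν : ν ≤ -N * (σ - 1)) : ∃ D : ℝ, ∀ s, 0 ≤ s → ‖saddleIntegral σ 1 s 0 ν‖ ≤
      D * (1 + s) ^ (-N) * Real.exp (-(1 - 1 / σ) * s ^ (σ / (σ - 1))) := by
  have hσ0 : 0 < σ := by linarith
  have hσ1 : 0 < σ - 1 := by linarith
  obtain ⟨B, hB⟩ := exists_norm_saddleIntegral_le hσ one_pos ν
  refine exists_norm_le_of_bounded_of_decay (M := ν / (σ - 1)) hN ?_ (by positivity)
    (by rwa [div_le_iff₀ hσ1]) (fun s hs => hB s 0 hs le_rfl)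
    (C := Real.exp (1 - 1 / σ) *
      ∫ u, ‖saddleKernel σ 1 1 0 ν (keyhole (sectorAngle σ) u)‖) fun s hs => ?_
  · rw [sub_nonneg, div_le_one hσ0]; exact hσ.le
  have hs0 : 0 < s := by linarith
  -- Balances `s e^L` against `e^(σL)`.
  set L := Real.log s / (σ - 1) with hL
  have hL0 : 0 ≤ L := div_nonneg (Real.log_nonneg hs) hσ1.le
  set Λ := Real.exp (σ * L) with hΛ
  have hΛ1 : 1 ≤ Λ := Real.one_le_exp (by positivity)
  have e1 : s * Real.exp L = Λ := by
    nth_rewrite 1 [← Real.exp_log hs0]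
    rw [← Real.exp_add, hΛ]
    congr 1
    rw [hL]; field_simp; ring
  have e2 : Λ = s ^ (σ / (σ - 1)) := by
    rw [Real.rpow_def_of_pos hs0, hΛ, hL]; congr 1; ring
  have e3 : Real.exp (ν * L) = s ^ (ν / (σ - 1)) := by
    rw [Real.rpow_def_of_pos hs0, hL]; congr 1; ring
  rw [saddleIntegral_shift hσ one_pos ν hs0.le le_rfl L, one_mul, e1, zero_mul, ← hΛ, norm_mul,
    Complex.norm_real, Real.norm_of_nonneg (Real.exp_nonneg _), e3, ← e2]
  have hI := (integrable_saddle hσ one_pos ν (s := 1) (t := 0) zero_le_one le_rfl).norm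
  simp only [norm_mul, norm_keyholeDir, one_mul] at hI
  have hle : ‖saddleIntegral σ Λ Λ 0 ν‖ ≤ ∫ u, Real.exp (-(1 - 1 / σ) * (Λ - 1)) *
      ‖saddleKernel σ 1 1 0 ν (keyhole (sectorAngle σ) u)‖ := by
    refine norm_integral_le_of_norm_le (hI.const_mul _) (Filter.Eventually.of_forall fun u => ?_)
    rw [norm_mul, norm_keyholeDir, one_mul]
    exact norm_saddleKernel_keyhole_le hσ hΛ1 ν u
  rw [integral_const_mul] at hle
  calc _ ≤ s ^ (ν / (σ - 1)) * (Real.exp (-(1 - 1 / σ) * (Λ - 1)) *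
      ∫ u, ‖saddleKernel σ 1 1 0 ν (keyhole (sectorAngle σ) u)‖) := by gcongr
    _ = _ := by
      have : -(1 - 1 / σ) * (Λ - 1) = (1 - 1 / σ) + -(1 - 1 / σ) * Λ := by ring
      rw [this, Real.exp_add]; ring

/-- The phase `-e^(-w) + e^(σw) / σ` is stationary where `e^((σ+1)w) = -1`, that is at `± iθ` with
`θ = π / (σ + 1)`. The contour is therefore opened to the two full lines through these points, where
the real part is `-cos θ (e^(-x) + e^(σx) / σ)`. -/
theorem saddleIntegral_frequency_decay {σ N ν : ℝ} (hσ : 1 < σ) (hN : 0 ≤ N)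
    (hν : ν ≤ -N * (σ + 1)) : ∃ D : ℝ, ∀ t, 0 ≤ t → ‖saddleIntegral σ 1 0 t ν‖ ≤
      D * (1 + t) ^ (-N) *
        Real.exp (-(Real.cos (sectorAngle σ) * (1 + 1 / σ)) * t ^ (σ / (σ + 1))) := by
  have hσ0 : 0 < σ := by linarith
  have hσ1 : 0 < σ + 1 := by linarith
  have hS := cos_sectorAngle_pos hσ
  have hp : |sectorAngle σ| = sectorAngle σ := abs_of_pos (sectorAngle_pos hσ)
  have hm : |-sectorAngle σ| = sectorAngle σ := by rw [abs_neg, hp]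
  obtain ⟨B, hB⟩ := exists_norm_saddleIntegral_le hσ one_pos ν
  set k := Real.cos (sectorAngle σ) * (1 + 1 / σ) with hk
  have hk0 : 0 ≤ k := by positivity
  have hIr : ∀ φ : ℝ, |φ| = sectorAngle σ → Integrable fun x : ℝ =>
      ‖saddleKernel σ 1 0 1 ν (x + φ * Complex.I)‖ := fun φ hφ =>
    (integrable_saddle_ray hσ one_pos le_rfl zero_le_one (Or.inl one_pos) hφ).norm
  set I₁ := ∫ x : ℝ, ‖saddleKernel σ 1 0 1 ν (x + (sectorAngle σ : ℝ) * Complex.I)‖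
  set I₂ := ∫ x : ℝ, ‖saddleKernel σ 1 0 1 ν (x + (-sectorAngle σ : ℝ) * Complex.I)‖
  refine exists_norm_le_of_bounded_of_decay (M := ν / (σ + 1)) hN hk0 (by positivity)
    (by rwa [div_le_iff₀ hσ1]) (fun t ht => hB 0 t le_rfl ht)
    (C := Real.exp k * (I₁ + I₂)) fun t ht => ?_
  have ht0 : 0 < t := by linarith
  -- Balances `t e^(-L)` against `e^(σL)`.
  set L := Real.log t / (σ + 1) with hL
  have hL0 : 0 ≤ L := div_nonneg (Real.log_nonneg ht) hσ1.le
  set Λ := Real.exp (σ * L) with hΛ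
  have hΛ1 : 1 ≤ Λ := Real.one_le_exp (by positivity)
  have e1 : t * Real.exp (-L) = Λ := by
    nth_rewrite 1 [← Real.exp_log ht0]
    rw [← Real.exp_add, hΛ]
    congr 1
    rw [hL]; field_simp; ring
  have e2 : Λ = t ^ (σ / (σ + 1)) := by
    rw [Real.rpow_def_of_pos ht0, hΛ, hL]; congr 1; ring
  have e3 : Real.exp (ν * L) = t ^ (ν / (σ + 1)) := by
    rw [Real.rpow_def_of_pos ht0, hL]; congr 1; ring
  rw [saddleIntegral_shift hσ one_pos ν le_rfl ht0.le L, one_mul, e1, zero_mul, ← hΛ, norm_mul,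
    Complex.norm_real, Real.norm_of_nonneg (Real.exp_nonneg _), e3, ← e2,
    saddleIntegral_eq_rays hσ (by positivity) le_rfl (by positivity) (Or.inl (by positivity))]
  have hle : ∀ φ : ℝ, |φ| = sectorAngle σ →
      ‖∫ x : ℝ, saddleKernel σ Λ 0 Λ ν (x + φ * Complex.I)‖ ≤ Real.exp (-k * (Λ - 1)) *
        ∫ x : ℝ, ‖saddleKernel σ 1 0 1 ν (x + φ * Complex.I)‖ := by
    intro φ hφ
    rw [← integral_const_mul]
    refine norm_integral_le_of_norm_le ((hIr φ hφ).const_mul _)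
      (Filter.Eventually.of_forall fun x => ?_)
    rw [norm_saddleKernel_ray hσ hφ, norm_saddleKernel_ray hσ hφ,
      ← Real.exp_add (-k * (Λ - 1)), Real.exp_le_exp]
    -- The tangent-line bounds at `0` have cancelling linear terms, which locates the minimum at `x
    -- = 0`.
    have h1 : 1 + 1 / σ ≤ Real.exp (-x) + 1 / σ * Real.exp (σ * x) := by
      have a1 := Real.add_one_le_exp (-x)
      have a2 := mul_le_mul_of_nonneg_left (Real.add_one_le_exp (σ * x))
        (by positivity : 0 ≤ 1 / σ)
      have a3 : 1 / σ * (σ * x + 1) = x + 1 / σ := by field_simp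
      linarith
    have h2 := mul_le_mul_of_nonneg_left h1
      (mul_nonneg hS.le (sub_nonneg.2 hΛ1))
    have e : Λ / σ * Real.exp (σ * x) = Λ * (1 / σ * Real.exp (σ * x)) := by ring
    rw [e, hk]
    linarith
  calc _ ≤ t ^ (ν / (σ + 1)) * (Real.exp (-k * (Λ - 1)) * I₁ + Real.exp (-k * (Λ - 1)) * I₂) := by
        gcongr
        exact (norm_sub_le _ _).trans (add_le_add (hle _ hp) (hle _ hm))
    _ = _ := by
      have : -k * (Λ - 1) = k + -k * Λ := by ring
      rw [this, Real.exp_add]; ring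

/-! ### Superposition of Gaussians: Fourier transform and derivative. -/

theorem keyhole_re_nonneg (θ u : ℝ) : 0 ≤ (keyhole θ u).re := by
  simp [keyhole]

theorem abs_keyhole_im_le {θ : ℝ} (hθ : 0 ≤ θ) (u : ℝ) : |(keyhole θ u).im| ≤ θ := by
  have : (keyhole θ u).im = max (-θ) (min u θ) := by simp [keyhole]
  rw [this, abs_le]
  exact ⟨le_max_left _ _, max_le (by linarith) (min_le_right _ _)⟩

/-- Because the keyhole stays in `Re w ≥ 0`, all the Gaussians share a positive decay rate; this is
what justifies Fubini. -/
theorem le_exp_keyhole_re {σ : ℝ} (hσ : 1 < σ) (u : ℝ) :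
    Real.cos (sectorAngle σ) ≤ (Complex.exp (keyhole (sectorAngle σ) u)).re := by
  rw [Complex.exp_re]
  have h1 := cos_nonneg_of_abs_le_sectorAngle hσ (abs_keyhole_im_le (sectorAngle_pos hσ).le u)
  exact h1.trans (le_mul_of_one_le_left ((cos_sectorAngle_pos hσ).le.trans h1)
    (Real.one_le_exp (keyhole_re_nonneg _ _)))

theorem saddleKernel_eq_mul (σ A s t ν : ℝ) (w : ℂ) :
    saddleKernel σ A s t ν w = Complex.exp (-(s : ℂ) * Complex.exp w) * saddleKernel σ A 0 t ν w := by
  unfold saddleKernel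
  rw [← Complex.exp_add]
  congr 1
  push_cast; ring

/-- The endpoint `0` is included so that relations obtained by differentiating on `s > 0` pass to
the limit `s → 0`. -/
theorem continuousOn_saddleIntegral {σ A : ℝ} (hσ : 1 < σ) (hA : 0 < A) (ν : ℝ) :
    ContinuousOn (fun s => saddleIntegral σ A s 0 ν) (Set.Ici 0) := by
  obtain ⟨C, hC⟩ := exists_norm_saddleKernel_keyhole_le hσ hA ν
  refine continuousOn_of_dominated (bound := fun u => C * Real.exp (-|u|))
    (fun s hs => (integrable_saddle hσ hA ν hs le_rfl).aestronglyMeasurable)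
    (fun s hs => Filter.Eventually.of_forall fun u => ?_) (integrable_exp_neg_abs.const_mul C)
    (Filter.Eventually.of_forall fun u => ?_)
  · rw [norm_mul, norm_keyholeDir, one_mul]
    exact hC s 0 u hs le_rfl
  · unfold saddleKernel
    fun_prop

theorem hasDerivAt_saddleIntegral {σ A : ℝ} (hσ : 1 < σ) (hA : 0 < A) (ν : ℝ) {s : ℝ} (hs : 0 < s) :
    HasDerivAt (fun s => saddleIntegral σ A s 0 ν) (-saddleIntegral σ A s 0 (ν + 1)) s := by
  obtain ⟨C, hC⟩ := exists_norm_saddleKernel_keyhole_le hσ hA (ν + 1)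
  rw [saddleIntegral, ← integral_neg]
  refine (hasDerivAt_integral_of_dominated_loc_of_deriv_le
    (F := fun (s : ℝ) u => keyholeDir (sectorAngle σ) u *
      saddleKernel σ A s 0 ν (keyhole (sectorAngle σ) u))
    (F' := fun (s : ℝ) u => -(keyholeDir (sectorAngle σ) u *
      saddleKernel σ A s 0 (ν + 1) (keyhole (sectorAngle σ) u)))
    (bound := fun u => C * Real.exp (-|u|)) (Ioi_mem_nhds hs) ?_
    (integrable_saddle hσ hA ν hs.le le_rfl)
    (integrable_saddle hσ hA (ν + 1) hs.le le_rfl).aestronglyMeasurable.neg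
    (Filter.Eventually.of_forall fun u s' hs' => ?_) (integrable_exp_neg_abs.const_mul C)
    (Filter.Eventually.of_forall fun u s' _ => ?_)).2
  · filter_upwards [Ioi_mem_nhds hs] with s' hs'
    exact (integrable_saddle hσ hA ν (le_of_lt hs') le_rfl).aestronglyMeasurable
  · rw [norm_neg, norm_mul, norm_keyholeDir, one_mul]
    exact hC s' 0 u (le_of_lt hs') le_rfl
  · rw [← mul_neg]
    refine HasDerivAt.const_mul _ ?_
    set w := keyhole (sectorAngle σ) u
    have h1 : HasDerivAt (fun s : ℝ => -(s : ℂ) * Complex.exp w - ((0 : ℝ) : ℂ) * Complex.exp (-w) +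
        ((A / σ : ℝ) : ℂ) * Complex.exp ((σ : ℂ) * w) + (ν : ℂ) * w) (-1 * Complex.exp w) s' := by
      have := ((Complex.ofRealCLM.hasDerivAt (x := s')).neg.mul_const (Complex.exp w))
      simpa using ((this.sub_const (((0 : ℝ) : ℂ) * Complex.exp (-w))).add_const
        (((A / σ : ℝ) : ℂ) * Complex.exp ((σ : ℂ) * w))).add_const ((ν : ℂ) * w)
    convert! h1.cexp using 1
    rw [neg_one_mul, mul_neg, ← Complex.exp_add, saddleKernel]
    congr 2
    push_cast; ring

/-- The principal branch is the right one since `|Im w| < π`. The Gaussian normalization thus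
becomes a shift of `ν` by `-c`. -/
theorem cpow_pi_div_mul_exp {ℓ : ℝ} (hℓ : 0 < ℓ) {w : ℂ} (hw : |w.im| < Real.pi) (c : ℝ) :
    ((Real.pi : ℂ) / ((ℓ : ℂ) * Complex.exp w)) ^ (c : ℂ) =
      (((Real.pi / ℓ) ^ c : ℝ) : ℂ) * Complex.exp (-(c : ℂ) * w) := by
  have hr : 0 < Real.pi / ℓ := div_pos Real.pi_pos hℓ
  have e : (Real.pi : ℂ) / ((ℓ : ℂ) * Complex.exp w) =
      ((Real.pi / ℓ : ℝ) : ℂ) * Complex.exp (-w) := by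
    rw [Complex.exp_neg]; push_cast; field_simp
  have hw' := abs_lt.1 hw
  rw [e, Complex.cpow_def_of_ne_zero
    (mul_ne_zero (Complex.ofReal_ne_zero.2 hr.ne') (Complex.exp_ne_zero _)),
    Complex.log_ofReal_mul hr (Complex.exp_ne_zero _),
    Complex.log_exp (by simp; linarith) (by simp; linarith), add_mul, Complex.exp_add,
    Real.rpow_def_of_pos hr, Complex.ofReal_exp]
  push_cast
  congr 2; ring

/-- The Fourier transform of a contour superposition of Gaussians. -/
theorem fourierHat_saddleIntegral {m : ℕ} {σ ℓ : ℝ} (hσ : 1 < σ) (hℓ : 0 < ℓ) (ν : ℝ)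
    (y : EuclideanSpace ℝ (Fin (m + 1))) :
    fourierHat (fun x : EuclideanSpace ℝ (Fin (m + 1)) => saddleIntegral σ 1 (ℓ * ‖x‖ ^ 2) 0 ν) y =
      (((Real.pi / ℓ) ^ (((m + 1 : ℕ) : ℝ) / 2) : ℝ) : ℂ) *
        saddleIntegral σ 1 0 (‖y‖ ^ 2 / (4 * ℓ)) (ν - ((m + 1 : ℕ) : ℝ) / 2) := by
  have hS := cos_sectorAngle_pos hσ
  set θ := sectorAngle σ with hθ
  set φ : ℝ → ℂ := fun u => keyholeDir θ u * saddleKernel σ 1 0 0 ν (keyhole θ u) with hφ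
  have hφi : Integrable φ := integrable_saddle hσ one_pos ν le_rfl le_rfl
  set F : EuclideanSpace ℝ (Fin (m + 1)) → ℝ → ℂ := fun x u =>
    φ u * Complex.exp (-((ℓ : ℂ) * Complex.exp (keyhole θ u)) * ((‖x‖ : ℝ) : ℂ) ^ 2 +
      (-Complex.I) * ((inner ℝ y x : ℝ) : ℂ)) with hF
  have hFint : Integrable (Function.uncurry F) (volume.prod volume) := by
    have hgauss : Integrable fun x : EuclideanSpace ℝ (Fin (m + 1)) =>
        Real.exp (-(ℓ * Real.cos θ) * ‖x‖ ^ (2 : ℝ)) :=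
      integrable_exp_neg_mul_norm_rpow (by positivity) two_pos
    refine (hgauss.mul_prod hφi.norm).mono' ?_ (Filter.Eventually.of_forall fun p => ?_)
    · refine (hφi.aestronglyMeasurable.comp_snd).mul (Continuous.aestronglyMeasurable ?_)
      have := continuous_keyhole θ
      fun_prop
    · have hre := mul_le_mul_of_nonneg_left (le_exp_keyhole_re hσ p.2)
        (by positivity : 0 ≤ ℓ * ‖p.1‖ ^ 2)
      simp only [Function.uncurry, hF, norm_mul, Complex.norm_exp]
      rw [mul_comm ‖φ p.2‖]
      gcongr
      rw [Real.rpow_two, Complex.add_re, ← Complex.ofReal_pow, mul_comm (-(_ * _)) _,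
        Complex.re_ofReal_mul, Complex.neg_re, Complex.re_ofReal_mul]
      simp only [Complex.mul_re, Complex.neg_re, Complex.I_re, Complex.ofReal_re, Complex.neg_im,
        Complex.I_im, Complex.ofReal_im]
      rw [← hθ] at hre
      linarith
  have h1 : ∀ x : EuclideanSpace ℝ (Fin (m + 1)), saddleIntegral σ 1 (ℓ * ‖x‖ ^ 2) 0 ν *
      Complex.exp (-Complex.I * ((inner ℝ x y : ℝ) : ℂ)) = ∫ u, F x u := fun x => by
    rw [saddleIntegral, ← integral_mul_const]
    congr 1; ext u
    rw [saddleKernel_eq_mul, ← hθ]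
    simp only [hF, hφ]
    rw [real_inner_comm x y]
    rw [Complex.exp_add]
    push_cast
    ring_nf
  rw [fourierHat]
  simp only [h1]
  rw [integral_integral_swap hFint, saddleIntegral, ← integral_const_mul]
  congr 1; ext u
  have hre : 0 < ((ℓ : ℂ) * Complex.exp (keyhole θ u)).re := by
    rw [Complex.re_ofReal_mul]
    exact mul_pos hℓ (hS.trans_le (le_exp_keyhole_re hσ u))
  have hg := GaussianFourier.integral_cexp_neg_mul_sq_norm_add hre (-Complex.I) y
  have him : |(keyhole θ u).im| < Real.pi :=
    (abs_keyhole_im_le (sectorAngle_pos hσ).le u).trans_lt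
      (by linarith [sectorAngle_lt hσ, Real.pi_pos])
  have hc := cpow_pi_div_mul_exp hℓ him (((m + 1 : ℕ) : ℝ) / 2)
  simp only [hF]
  rw [integral_const_mul, hg, finrank_euclideanSpace, Fintype.card_fin]
  rw [show (((m + 1 : ℕ) : ℂ) / 2) = ((((m + 1 : ℕ) : ℝ) / 2 : ℝ) : ℂ) by push_cast; ring, hc]
  simp only [hφ]
  have hk : saddleKernel σ 1 0 (‖y‖ ^ 2 / (4 * ℓ)) (ν - ((m + 1 : ℕ) : ℝ) / 2) (keyhole θ u) =
      saddleKernel σ 1 0 0 ν (keyhole θ u) *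
      Complex.exp (-((((m + 1 : ℕ) : ℝ) / 2 : ℝ) : ℂ) * keyhole θ u) *
      Complex.exp ((-Complex.I) ^ 2 * ((‖y‖ : ℝ) : ℂ) ^ 2 /
        (4 * ((ℓ : ℂ) * Complex.exp (keyhole θ u)))) := by
    have hℓ' : (ℓ : ℂ) ≠ 0 := Complex.ofReal_ne_zero.2 hℓ.ne'
    have he := Complex.exp_ne_zero (keyhole θ u)
    have e1 : (-Complex.I) ^ 2 * ((‖y‖ : ℝ) : ℂ) ^ 2 / (4 * ((ℓ : ℂ) * Complex.exp (keyhole θ u))) =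
        -(((‖y‖ ^ 2 / (4 * ℓ) : ℝ) : ℂ) * Complex.exp (-keyhole θ u)) := by
      rw [Complex.exp_neg, neg_sq, Complex.I_sq]
      push_cast
      field_simp
    rw [e1]
    unfold saddleKernel
    rw [← Complex.exp_add, ← Complex.exp_add]
    congr 1
    push_cast; ring
  rw [← hθ, hk]
  ring

/-! ### Values at the origin and linear independence. -/

open Filter Topology in
/-- Translating a horizontal line of integration. -/
theorem integral_horizontal_line_eq {f : ℂ → ℂ} (hf : Differentiable ℂ f) {y₀ y₁ : ℝ} {g : ℝ → ℝ}
    (hg : Integrable g) (hbot : Tendsto g atBot (𝓝 0)) (htop : Tendsto g atTop (𝓝 0))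
    (hle : ∀ x : ℝ, ∀ y ∈ Set.uIcc y₀ y₁, ‖f (x + y * Complex.I)‖ ≤ g x) :
    ∫ x : ℝ, f (x + y₀ * Complex.I) = ∫ x : ℝ, f (x + y₁ * Complex.I) := by
  have hint : ∀ y ∈ Set.uIcc y₀ y₁, Integrable fun x : ℝ => f (x + y * Complex.I) := fun y hy =>
    hg.mono' (hf.continuous.comp (by fun_prop)).aestronglyMeasurable
      (Eventually.of_forall fun x => hle x y hy)
  have hlim : ∀ y ∈ Set.uIcc y₀ y₁, Tendsto (fun R : ℝ => ∫ x in (-R)..R, f (x + y * Complex.I))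
      atTop (𝓝 (∫ x : ℝ, f (x + y * Complex.I))) := fun y hy =>
    intervalIntegral_tendsto_integral (hint y hy) tendsto_neg_atTop_atBot tendsto_id
  have hside : ∀ h : ℝ → ℝ, Tendsto (fun R => g (h R)) atTop (𝓝 0) →
      Tendsto (fun R : ℝ => ∫ y in y₀..y₁, f (h R + y * Complex.I)) atTop (𝓝 0) := fun h hh => by
    have := hh.mul_const |y₁ - y₀|
    rw [zero_mul] at this
    refine squeeze_zero_norm (fun R => ?_) this
    exact intervalIntegral.norm_integral_le_of_norm_le_const fun y hy =>
      hle _ y (Set.uIoc_subset_uIcc hy)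
  have h1 := hside (fun R => R) htop
  have h2 := hside (fun R => -R) (hbot.comp tendsto_neg_atTop_atBot)
  have hsum := (((hlim y₀ Set.left_mem_uIcc).sub (hlim y₁ Set.right_mem_uIcc)).add
    (h1.const_mul Complex.I)).sub (h2.const_mul Complex.I)
  rw [mul_zero, add_zero, sub_zero] at hsum
  refine sub_eq_zero.1 (tendsto_nhds_unique hsum (tendsto_const_nhds.congr fun R => ?_))
  have hrect := Complex.integral_boundary_rect_eq_zero_of_differentiableOn f ⟨-R, y₀⟩ ⟨R, y₁⟩
    hf.differentiableOn
  simp only [smul_eq_mul] at hrect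
  exact hrect.symm

theorem cos_mul_le_of_mem {σ y : ℝ} (hσ : 1 < σ) (h1 : sectorAngle σ ≤ |y|)
    (h2 : |y| ≤ Real.pi / σ) : Real.cos (σ * y) ≤ -Real.cos (sectorAngle σ) := by
  have hσ0 : 0 < σ := by linarith
  rw [← Real.cos_abs, abs_mul, abs_of_pos hσ0, ← cos_mul_sectorAngle hσ]
  refine Real.cos_le_cos_of_nonneg_of_le_pi (mul_nonneg hσ0.le (sectorAngle_pos hσ).le) ?_
    (by gcongr)
  rw [le_div_iff₀ hσ0] at h2
  linarith

open Filter Topology in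
-- On the lines `Im w = ± π/σ` one has `e^(σw) = -e^(σx)`, so the integrand is real up to a constant
-- phase. Throughout the strip in between `cos (σy) ≤ -cos θ`, so one majorant serves for the shift.
theorem integral_saddle_ray_eq {σ μ : ℝ} (hσ : 1 < σ) (hμ : 0 < μ) {ε : ℝ} (hε : |ε| = 1) :
    ∫ x : ℝ, saddleKernel σ 1 0 0 μ (x + (ε * sectorAngle σ : ℝ) * Complex.I) =
      Complex.exp ((ε * (Real.pi * (μ / σ)) : ℝ) * Complex.I) *
        ∫ x : ℝ, ((Real.exp (μ * x - 1 / σ * Real.exp (σ * x)) : ℝ) : ℂ) := by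
  have hσ0 : 0 < σ := by linarith
  have hS := cos_sectorAngle_pos hσ
  have hθ0 := sectorAngle_pos hσ
  have hθσ : sectorAngle σ ≤ Real.pi / σ :=
    div_le_div_of_nonneg_left Real.pi_pos.le hσ0 (by linarith)
  have hp : |sectorAngle σ| = sectorAngle σ := abs_of_pos hθ0
  have hk : 0 < Real.cos (sectorAngle σ) * (1 / σ) := by positivity
  set g : ℝ → ℝ := fun x =>
    Real.exp (μ * x - Real.cos (sectorAngle σ) * (1 / σ) * Real.exp (σ * x)) with hg
  have hgi : Integrable g := by
    refine (integrable_saddle_ray hσ one_pos (ν := μ) le_rfl le_rfl (Or.inr hμ) hp).norm.congr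
      (Eventually.of_forall fun x => ?_)
    simp only [hg]
    rw [norm_saddleKernel_ray hσ hp]
    ring_nf
  have hbot : Tendsto g atBot (𝓝 0) := by
    refine squeeze_zero (fun x => Real.exp_nonneg _) (fun x => ?_)
      (Real.tendsto_exp_atBot.comp (tendsto_id.const_mul_atBot hμ))
    simp only [hg, Function.comp, id]
    rw [Real.exp_le_exp]
    have : 0 < Real.cos (sectorAngle σ) * (1 / σ) * Real.exp (σ * x) := by positivity
    linarith
  have htop : Tendsto g atTop (𝓝 0) := by
    obtain ⟨C, hC⟩ := exists_mul_sub_exp_le hσ0 hk μ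
    refine squeeze_zero' (Eventually.of_forall fun x => Real.exp_nonneg _) ?_
      (Real.tendsto_exp_atBot.comp (tendsto_atBot_add_const_left atTop C tendsto_neg_atTop_atBot))
    filter_upwards [eventually_ge_atTop 0] with x hx
    simp only [hg, Function.comp]
    rw [Real.exp_le_exp]
    have := hC x hx
    linarith
  have habs : ∀ y ∈ Set.uIcc (ε * sectorAngle σ) (ε * (Real.pi / σ)),
      sectorAngle σ ≤ |y| ∧ |y| ≤ Real.pi / σ := by
    intro y hy
    rcases (abs_eq zero_le_one).1 hε with rfl | rfl
    · rw [one_mul, one_mul, Set.uIcc_of_le hθσ] at hy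
      rw [abs_of_pos (hθ0.trans_le hy.1)]; exact hy
    · rw [neg_one_mul, neg_one_mul, Set.uIcc_of_ge (neg_le_neg hθσ)] at hy
      rw [abs_of_neg (hy.2.trans_lt (neg_lt_zero.2 hθ0))]
      exact ⟨by linarith [hy.2], by linarith [hy.1]⟩
  have hle : ∀ x : ℝ, ∀ y ∈ Set.uIcc (ε * sectorAngle σ) (ε * (Real.pi / σ)),
      ‖saddleKernel σ 1 0 0 μ (x + y * Complex.I)‖ ≤ g x := by
    intro x y hy
    have hc := cos_mul_le_of_mem hσ (habs y hy).1 (habs y hy).2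
    have := mul_le_mul_of_nonneg_left hc (by positivity : 0 ≤ 1 / σ * Real.exp (σ * x))
    simp only [hg]
    rw [norm_saddleKernel, Real.exp_le_exp]
    linarith
  rw [integral_horizontal_line_eq (differentiable_saddleKernel σ 1 0 0 μ) hgi hbot htop hle,
    ← integral_const_mul]
  congr 1; ext x
  have hσ' : (σ : ℂ) ≠ 0 := Complex.ofReal_ne_zero.2 hσ0.ne'
  have e1 : Complex.exp ((σ : ℂ) * (x + (ε * (Real.pi / σ) : ℝ) * Complex.I)) =
      -((Real.exp (σ * x) : ℝ) : ℂ) := by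
    have : (σ : ℂ) * (x + (ε * (Real.pi / σ) : ℝ) * Complex.I) =
        ((σ * x : ℝ) : ℂ) + ε * (Real.pi * Complex.I) := by
      push_cast; field_simp
    rw [this, Complex.exp_add, ← Complex.ofReal_exp]
    rcases (abs_eq zero_le_one).1 hε with rfl | rfl
    · simp [Complex.exp_pi_mul_I]
    · simp [Complex.exp_neg, Complex.exp_pi_mul_I]
  rw [saddleKernel, e1, Complex.ofReal_exp (μ * x - _), ← Complex.exp_add]
  congr 1
  push_cast
  field_simp
  ring

/-- Euler's integral after the substitution `v = e^(σx)`. -/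
theorem integral_exp_mul_sub_exp {σ μ : ℝ} (hσ : 0 < σ) (hμ : 0 < μ) :
    ∫ x : ℝ, Real.exp (μ * x - 1 / σ * Real.exp (σ * x)) =
      1 / σ * (σ ^ (μ / σ) * Real.Gamma (μ / σ)) := by
  have himg : (fun x : ℝ => Real.exp (σ * x)) '' Set.univ = Set.Ioi 0 := by
    rw [Set.image_univ]
    ext v
    constructor
    · rintro ⟨x, rfl⟩; exact Real.exp_pos _
    · intro hv
      exact ⟨Real.log v / σ, by simp only; rw [mul_div_cancel₀ _ hσ.ne', Real.exp_log hv]⟩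
  have hderiv : ∀ x ∈ Set.univ, HasDerivWithinAt (fun x : ℝ => Real.exp (σ * x))
      (σ * Real.exp (σ * x)) Set.univ x := fun x _ => by
    have := ((hasDerivAt_id x).const_mul σ).exp
    simp only [id, mul_one] at this
    rw [mul_comm σ (Real.exp _)]
    exact this.hasDerivWithinAt
  have hinj : Set.InjOn (fun x : ℝ => Real.exp (σ * x)) Set.univ := fun x _ y _ h => by
    simpa [hσ.ne'] using h
  have h := integral_image_eq_integral_abs_deriv_smul MeasurableSet.univ hderiv hinj
    (fun v => v ^ (μ / σ - 1) * Real.exp (-(1 / σ * v)))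
  rw [himg, Real.integral_rpow_mul_exp_neg_mul_Ioi (by positivity) (by positivity), one_div_one_div,
    Measure.restrict_univ] at h
  rw [h, ← integral_const_mul]
  congr 1; ext x
  rw [abs_of_pos (by positivity), smul_eq_mul, ← Real.exp_mul, sub_eq_add_neg, Real.exp_add]
  have : Real.exp (μ * x) = Real.exp (σ * x) * Real.exp (σ * x * (μ / σ - 1)) := by
    rw [← Real.exp_add]; congr 1; field_simp; ring
  rw [this]
  field_simp

theorem saddleIntegral_zero_zero {σ μ : ℝ} (hσ : 1 < σ) (hμ : 0 < μ) :
    saddleIntegral σ 1 0 0 μ = 2 * Complex.I * ((1 / σ * Real.sin (Real.pi * (μ / σ)) *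
      (σ ^ (μ / σ) * Real.Gamma (μ / σ)) : ℝ) : ℂ) := by
  have h1 := integral_saddle_ray_eq hσ hμ (ε := 1) (by simp)
  have h2 := integral_saddle_ray_eq hσ hμ (ε := -1) (by simp)
  rw [one_mul, one_mul] at h1
  rw [neg_one_mul, neg_one_mul] at h2
  rw [saddleIntegral_eq_rays hσ one_pos le_rfl le_rfl (Or.inr hμ), h1, h2, ← sub_mul,
    integral_complex_ofReal, integral_exp_mul_sub_exp (by linarith) hμ]
  have h3 : Complex.exp ((Real.pi * (μ / σ) : ℝ) * Complex.I) -
      Complex.exp ((-(Real.pi * (μ / σ)) : ℝ) * Complex.I) =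
      2 * Complex.I * ((Real.sin (Real.pi * (μ / σ)) : ℝ) : ℂ) := by
    rw [Complex.exp_ofReal_mul_I, Complex.exp_ofReal_mul_I]
    simp only [Complex.ofReal_neg, Real.cos_neg, Real.sin_neg]
    push_cast
    ring
  rw [h3]
  push_cast
  ring

open Filter Topology in
theorem tendsto_Gamma_sub_div_Gamma_sub {i j : ℕ} (hij : j < i) :
    Tendsto (fun x : ℝ => Real.Gamma (x - i) / Real.Gamma (x - j)) atTop (𝓝 0) := by
  have h0 : Tendsto (fun x : ℝ => (x - i)⁻¹) atTop (𝓝 0) :=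
    tendsto_inv_atTop_zero.comp (tendsto_atTop_add_const_right _ _ tendsto_id)
  refine squeeze_zero' ?_ ?_ h0
  · filter_upwards [eventually_gt_atTop (i : ℝ)] with x hx
    have : (j : ℝ) < i := by exact_mod_cast hij
    exact div_nonneg (Real.Gamma_pos_of_pos (by linarith)).le
      (Real.Gamma_pos_of_pos (by linarith)).le
  · filter_upwards [eventually_ge_atTop ((i : ℝ) + 1)] with x hx
    have hij' : (j : ℝ) + 1 ≤ i := by exact_mod_cast hij
    have hpos := Real.Gamma_pos_of_pos (by linarith : 0 < x - i)
    have h1 : Real.Gamma (x - i + 1) ≤ Real.Gamma (x - j) :=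
      Real.Gamma_strictMonoOn_Ici.monotoneOn (Set.mem_Ici.2 (by linarith))
        (Set.mem_Ici.2 (by linarith)) (by linarith)
    rw [Real.Gamma_add_one (by linarith)] at h1
    have hxi : 0 < x - i := by linarith
    rw [div_le_iff₀ ((mul_pos hxi hpos).trans_le h1), inv_mul_eq_div, le_div_iff₀ hxi]
    linarith

open Filter Topology in
/-- Translates of the Gamma function by distinct natural numbers are linearly independent. -/
theorem eq_zero_of_sum_mul_Gamma_eq_zero {s : Finset ℕ} {a : ℕ → ℂ}
    (h : ∃ᶠ x : ℝ in atTop, ∑ j ∈ s, a j * ((Real.Gamma (x - j) : ℝ) : ℂ) = 0) :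
    ∀ j ∈ s, a j = 0 := by
  intro j
  induction j using Nat.strong_induction_on with
  | _ j ih =>
  intro hj
  -- After division by `Γ(x - j)`, smaller indices are gone by induction and larger ones tend to
  -- `0`, so only `a j` survives.
  have hlim : Tendsto (fun x : ℝ => ∑ i ∈ s, a i *
      ((Real.Gamma (x - i) / Real.Gamma (x - j) : ℝ) : ℂ)) atTop
      (𝓝 (∑ i ∈ s, if i = j then a j else 0)) := by
    refine tendsto_finsetSum _ fun i hi => ?_
    rcases lt_trichotomy i j with hlt | rfl | hgt
    · rw [ih i hlt hi, if_neg hlt.ne]; simp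
    · rw [if_pos rfl]
      refine (tendsto_const_nhds (x := a i)).congr' ?_
      filter_upwards [eventually_gt_atTop (i : ℝ)] with x hx
      rw [div_self (Real.Gamma_pos_of_pos (by linarith)).ne']; simp
    · rw [if_neg hgt.ne']
      have := (Complex.continuous_ofReal.tendsto 0).comp (tendsto_Gamma_sub_div_Gamma_sub hgt)
      simpa using this.const_mul (a i)
  rw [Finset.sum_ite_eq' s j, if_pos hj] at hlim
  by_contra hne
  refine h ((hlim.eventually_ne hne).mono fun x hx h0 => hx ?_)
  have : ∑ i ∈ s, a i * ((Real.Gamma (x - i) / Real.Gamma (x - j) : ℝ) : ℂ) =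
      (∑ i ∈ s, a i * ((Real.Gamma (x - i) : ℝ) : ℂ)) / ((Real.Gamma (x - j) : ℝ) : ℂ) := by
    rw [Finset.sum_div]
    refine Finset.sum_congr rfl fun i _ => ?_
    push_cast; ring
  rw [this, h0, zero_div]

theorem sin_pi_mul_sub_natCast (x : ℝ) (j : ℕ) :
    Real.sin (Real.pi * (x - j)) = (-1) ^ j * Real.sin (Real.pi * x) := by
  rw [mul_sub, mul_comm Real.pi (j : ℝ), Real.sin_sub_nat_mul_pi]

open Filter Topology in
-- Two consecutive zeros would make `1/σ`, which lies strictly between `0` and `1`, an integer.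
theorem frequently_sin_pi_mul_ne_zero {σ : ℝ} (hσ : 1 < σ) (ν : ℝ) :
    ∃ᶠ k : ℕ in atTop, Real.sin (Real.pi * ((ν + k) / σ)) ≠ 0 := by
  have hσ0 : 0 < σ := by linarith
  rw [frequently_atTop]
  intro N
  by_contra! hcon
  obtain ⟨p, hp⟩ := Real.sin_eq_zero_iff.1 (hcon N le_rfl)
  obtain ⟨q, hq⟩ := Real.sin_eq_zero_iff.1 (hcon (N + 1) (by omega))
  have hpi := Real.pi_pos
  have e : ((q - p : ℤ) : ℝ) = 1 / σ := by
    have h1 : (p : ℝ) = (ν + N) / σ := by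
      apply mul_right_cancel₀ hpi.ne'; rw [hp]; ring
    have h2 : (q : ℝ) = (ν + (N + 1 : ℕ)) / σ := by
      apply mul_right_cancel₀ hpi.ne'; rw [hq]; ring
    rw [Int.cast_sub, h1, h2]; push_cast; ring
  have h0 : (0 : ℝ) < ((q - p : ℤ) : ℝ) := by rw [e]; positivity
  have h1 : ((q - p : ℤ) : ℝ) < 1 := by rw [e, div_lt_one hσ0]; exact hσ
  have h0' : 0 < q - p := by exact_mod_cast h0
  have h1' : q - p < 1 := by exact_mod_cast h1
  omega

open Filter Topology in
-- Each derivative in `r` raises every parameter by one, up to a common sign, and `r → 0` leaves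
-- explicit Gamma values. The spacing `σ` makes the Gamma arguments differ by integers, so the sine
-- factors agree up to `(-1)^j` and cancel where they are nonzero.
theorem eq_zero_of_sum_saddleIntegral_eq_zero {σ ν : ℝ} (hσ : 1 < σ) {s : Finset ℕ} {g : ℕ → ℂ}
    (h : ∀ r : ℝ, 0 < r → ∑ j ∈ s, g j * saddleIntegral σ 1 r 0 (ν - σ * j) = 0) :
    ∀ j ∈ s, g j = 0 := by
  have hσ0 : 0 < σ := by linarith
  have hk : ∀ k : ℕ, ∀ r : ℝ, 0 < r →
      ∑ j ∈ s, g j * saddleIntegral σ 1 r 0 (ν - σ * j + k) = 0 := by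
    intro k
    induction k with
    | zero => simpa using h
    | succ k ih =>
      intro r hr
      have hd : HasDerivAt (fun r => ∑ j ∈ s, g j * saddleIntegral σ 1 r 0 (ν - σ * j + k))
          (∑ j ∈ s, g j * -saddleIntegral σ 1 r 0 (ν - σ * j + k + 1)) r :=
        HasDerivAt.fun_sum fun j _ => (hasDerivAt_saddleIntegral hσ one_pos _ hr).const_mul (g j)
      have hd0 : HasDerivAt (fun r => ∑ j ∈ s, g j * saddleIntegral σ 1 r 0 (ν - σ * j + k)) 0 r := by
        refine (hasDerivAt_const r (0 : ℂ)).congr_of_eventuallyEq ?_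
        filter_upwards [Ioi_mem_nhds hr] with r' hr' using ih r' hr'
      have := hd.unique hd0
      simp only [mul_neg, Finset.sum_neg_distrib, neg_eq_zero] at this
      rw [← this]
      refine Finset.sum_congr rfl fun j _ => ?_
      push_cast; rw [add_assoc]
  have hk0 : ∀ k : ℕ, ∑ j ∈ s, g j * saddleIntegral σ 1 0 0 (ν - σ * j + k) = 0 := by
    intro k
    have hc : ContinuousOn (fun r => ∑ j ∈ s, g j * saddleIntegral σ 1 r 0 (ν - σ * j + k))
        (Set.Ici 0) := continuousOn_finsetSum _ fun j _ =>
      continuousOn_const.mul (continuousOn_saddleIntegral hσ one_pos _)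
    have h1 := (hc 0 Set.self_mem_Ici).mono Set.Ioi_subset_Ici_self
    refine tendsto_nhds_unique h1 (tendsto_const_nhds.congr' ?_)
    filter_upwards [self_mem_nhdsWithin] with r hr using (hk k r hr).symm
  have hx : Tendsto (fun k : ℕ => (ν + k) / σ) atTop atTop :=
    (tendsto_atTop_add_const_left _ _ tendsto_natCast_atTop_atTop).atTop_div_const hσ0
  have hev : ∀ᶠ k : ℕ in atTop, ∀ j ∈ s, (j : ℝ) < (ν + k) / σ := by
    obtain ⟨N, hN⟩ := s.bddAbove
    filter_upwards [hx.eventually_gt_atTop (N : ℝ)] with k hk j hj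
    have : (j : ℝ) ≤ N := by exact_mod_cast hN hj
    linarith
  have hfreq := (frequently_sin_pi_mul_ne_zero hσ ν).and_eventually hev
  have key : ∀ j ∈ s, g j * ((((-σ⁻¹) ^ j : ℝ)) : ℂ) = 0 := by
    refine eq_zero_of_sum_mul_Gamma_eq_zero (hx.frequently (hfreq.mono fun k hk' => ?_))
    obtain ⟨hsin, hlt⟩ := hk'
    set x := (ν + k) / σ with hxdef
    have hterm : ∀ j ∈ s, g j * saddleIntegral σ 1 0 0 (ν - σ * j + k) =
        (2 * Complex.I * ((1 / σ * Real.sin (Real.pi * x) * σ ^ x : ℝ) : ℂ)) *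
          (g j * ((((-σ⁻¹) ^ j : ℝ)) : ℂ) * ((Real.Gamma (x - j) : ℝ) : ℂ)) := by
      intro j hj
      have e : (ν - σ * j + k) / σ = x - j := by rw [hxdef]; field_simp; ring
      have hpos : 0 < ν - σ * j + k := by
        have h1 : 0 < (ν - σ * j + k) / σ := by rw [e]; linarith [hlt j hj]
        simpa [hσ0] using (div_pos_iff_of_pos_right hσ0).1 h1
      rw [saddleIntegral_zero_zero hσ hpos, e, sin_pi_mul_sub_natCast, Real.rpow_sub hσ0,
        Real.rpow_natCast, neg_pow σ⁻¹, inv_pow]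
      push_cast
      ring
    have h0 := hk0 k
    rw [Finset.sum_congr rfl hterm, ← Finset.mul_sum] at h0
    refine (mul_eq_zero.1 h0).resolve_left ?_
    refine mul_ne_zero (by simp) (Complex.ofReal_ne_zero.2 ?_)
    have : σ ^ x ≠ 0 := (Real.rpow_pos_of_pos hσ0 x).ne'
    positivity
  intro j hj
  refine (mul_eq_zero.1 (key j hj)).resolve_right (Complex.ofReal_ne_zero.2 ?_)
  exact pow_ne_zero _ (neg_ne_zero.2 (inv_ne_zero hσ0.ne'))

/-! ### Assembling the extremal functions and the theorem. -/

theorem exists_polyAbs_le {n : ℕ} (Q : MvPolynomial (Fin n) ℂ) :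
    ∃ (C : ℝ) (d : ℕ), 0 ≤ C ∧ ∀ y : EuclideanSpace ℝ (Fin n), polyAbs Q y ≤ C * (1 + ‖y‖) ^ d := by
  induction Q using MvPolynomial.induction_on with
  | C a => exact ⟨‖a‖, 0, norm_nonneg _, fun y => by simp [polyAbs]⟩
  | add P Q hP hQ =>
    obtain ⟨C₁, d₁, h₁, hP⟩ := hP
    obtain ⟨C₂, d₂, h₂, hQ⟩ := hQ
    refine ⟨C₁ + C₂, d₁ + d₂, by positivity, fun y => ?_⟩
    have h1 : 1 ≤ 1 + ‖y‖ := by linarith [norm_nonneg y]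
    calc polyAbs (P + Q) y ≤ polyAbs P y + polyAbs Q y := by
          simpa [polyAbs] using norm_add_le _ _
      _ ≤ C₁ * (1 + ‖y‖) ^ (d₁ + d₂) + C₂ * (1 + ‖y‖) ^ (d₁ + d₂) := by
          refine add_le_add ((hP y).trans ?_) ((hQ y).trans ?_)
          · gcongr
            omega
          · gcongr
            omega
      _ = _ := by ring
  | mul_X P i hP =>
    obtain ⟨C, d, h, hP⟩ := hP
    refine ⟨C, d + 1, h, fun y => ?_⟩
    have h1 : |y i| ≤ 1 + ‖y‖ := by
      have : |y i| ≤ ‖y‖ := by simpa using PiLp.norm_apply_le y i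
      linarith
    calc polyAbs (P * MvPolynomial.X i) y = polyAbs P y * |y i| := by simp [polyAbs]
      _ ≤ C * (1 + ‖y‖) ^ d * (1 + ‖y‖) := by gcongr; exact hP y
      _ = _ := by ring

theorem exists_one_add_mul_sq_rpow_le {ℓ N : ℝ} (hℓ : 0 < ℓ) (hN : 0 ≤ N) :
    ∃ K : ℝ, 0 ≤ K ∧ ∀ r : ℝ, 0 ≤ r → (1 + ℓ * r ^ 2) ^ (-N) ≤ K * (1 + r) ^ (-N) := by
  set K := 2 + 1 / ℓ with hK
  have hK0 : 0 < K := by positivity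
  refine ⟨K ^ N, by positivity, fun r hr => ?_⟩
  have h1 : 1 + r ≤ K * (1 + ℓ * r ^ 2) := by
    have : K * (1 + ℓ * r ^ 2) = 2 + 1 / ℓ + 2 * ℓ * r ^ 2 + r ^ 2 := by
      rw [hK]; field_simp; ring
    have h2 : 0 < 1 / ℓ := by positivity
    have h3 : 0 ≤ 2 * ℓ * r ^ 2 := by positivity
    nlinarith [sq_nonneg (r - 1)]
  have h2 : (1 + r) / K ≤ 1 + ℓ * r ^ 2 := by rwa [div_le_iff₀' hK0]
  calc (1 + ℓ * r ^ 2) ^ (-N) ≤ ((1 + r) / K) ^ (-N) :=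
        Real.rpow_le_rpow_of_nonpos (by positivity) h2 (by linarith)
    _ = K ^ N * (1 + r) ^ (-N) := by
        rw [Real.div_rpow (by linarith) hK0.le, Real.rpow_neg hK0.le, div_inv_eq_mul, mul_comm]

theorem integrable_one_add_norm_rpow_neg {m : ℕ} {N : ℝ} (hN : ((m + 1 : ℕ) : ℝ) < N) :
    Integrable fun x : EuclideanSpace ℝ (Fin (m + 1)) => (1 + ‖x‖) ^ (-N) :=
  integrable_one_add_norm (by simpa using hN)

theorem spaceDecay_of_bound {m : ℕ} {a α D N : ℝ} {p : ℝ≥0∞} (hp : 1 ≤ p) (hα : 0 ≤ α)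
    {f : EuclideanSpace ℝ (Fin (m + 1)) → ℂ} (hf : Continuous f) (hN : ((m + 1 : ℕ) : ℝ) < N)
    (hb : ∀ x, Real.exp (a * ‖x‖ ^ α) * ‖f x‖ ≤ D * (1 + ‖x‖) ^ (-N)) : SpaceDecay a α p f := by
  have hN0 : 0 < N := lt_of_le_of_lt (Nat.cast_nonneg _) hN
  have hcont : Continuous fun x : EuclideanSpace ℝ (Fin (m + 1)) =>
      ((Real.exp (a * ‖x‖ ^ α) : ℝ) : ℂ) * f x := by
    have := (continuous_norm (E := EuclideanSpace ℝ (Fin (m + 1)))).rpow_const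
      (p := α) fun _ => Or.inr hα
    fun_prop
  have hnorm : ∀ x, ‖((Real.exp (a * ‖x‖ ^ α) : ℝ) : ℂ) * f x‖ =
      Real.exp (a * ‖x‖ ^ α) * ‖f x‖ := fun x => by
    rw [norm_mul, Complex.norm_real, Real.norm_of_nonneg (Real.exp_nonneg _)]
  have hD : 0 ≤ D := by
    have := (by positivity : 0 ≤ Real.exp (a * ‖(0 : EuclideanSpace ℝ (Fin (m + 1)))‖ ^ α) *
      ‖f 0‖).trans (hb 0)
    simpa using this
  have hle1 : ∀ x : EuclideanSpace ℝ (Fin (m + 1)), (1 + ‖x‖) ^ (-N) ≤ 1 := fun x =>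
    Real.rpow_le_one_of_one_le_of_nonpos (by linarith [norm_nonneg x]) (by linarith)
  by_cases hpt : p = ∞
  · rw [hpt]
    refine memLp_top_of_bound hcont.aestronglyMeasurable D (Filter.Eventually.of_forall fun x => ?_)
    rw [hnorm]
    exact (hb x).trans (mul_le_of_le_one_right hD (hle1 x))
  · have hp1 : 1 ≤ p.toReal := by simpa using ENNReal.toReal_mono hpt hp
    rw [SpaceDecay, ← integrable_norm_rpow_iff hcont.aestronglyMeasurable
      (one_pos.trans_le hp).ne' hpt]
    refine ((integrable_one_add_norm_rpow_neg hN).const_mul (D ^ p.toReal)).mono'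
      (hcont.norm.rpow_const fun _ => Or.inr (by linarith)).aestronglyMeasurable
      (Filter.Eventually.of_forall fun x => ?_)
    rw [Real.norm_of_nonneg (by positivity), hnorm]
    calc _ ≤ (D * (1 + ‖x‖) ^ (-N)) ^ p.toReal := Real.rpow_le_rpow (by positivity) (hb x) (by positivity)
      _ = D ^ p.toReal * ((1 + ‖x‖) ^ (-N)) ^ p.toReal := Real.mul_rpow hD (by positivity)
      _ ≤ _ := by
        gcongr
        exact Real.rpow_le_self_of_le_one (by positivity) (hle1 x) hp1

/-- The exponent `N` must pay for the dimension and for the growth `d δ` of the weight; since `1 +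
‖y‖ ≥ 1` and `q ≥ 1`, the `q`-th power only helps. -/
theorem fourierDecay_of_bound {m d : ℕ} {b β δ C D N : ℝ} {q : ℝ≥0∞} (hq : 1 ≤ q) (hδ : 0 < δ)
    {Q : MvPolynomial (Fin (m + 1)) ℂ} (hC : 0 ≤ C) (hQ : ∀ y, polyAbs Q y ≤ C * (1 + ‖y‖) ^ d)
    {f : EuclideanSpace ℝ (Fin (m + 1)) → ℂ} (hN : ((m + 1 : ℕ) : ℝ) + d * δ < N)
    (hb : ∀ y, Real.exp (b * ‖y‖ ^ β) * ‖fourierHat f y‖ ≤ D * (1 + ‖y‖) ^ (-N)) :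
    FourierDecay b β δ q Q f := by
  have hN0 : 0 < N := lt_of_le_of_lt (by positivity) hN
  have hD : 0 ≤ D := by
    have := (by positivity : 0 ≤ Real.exp (b * ‖(0 : EuclideanSpace ℝ (Fin (m + 1)))‖ ^ β) *
      ‖fourierHat f 0‖).trans (hb 0)
    simpa using this
  have hQδ : ∀ y, polyAbs Q y ^ δ ≤ C ^ δ * (1 + ‖y‖) ^ (d * δ) := fun y => by
    have h0 : 0 ≤ polyAbs Q y := norm_nonneg _
    calc _ ≤ (C * (1 + ‖y‖) ^ d) ^ δ := by gcongr; exact hQ y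
      _ = _ := by
        rw [Real.mul_rpow hC (by positivity), ← Real.rpow_natCast, ← Real.rpow_mul (by positivity)]
  have hQ0 : ∀ y, 0 ≤ polyAbs Q y ^ δ := fun y => Real.rpow_nonneg (norm_nonneg _) _
  have hprod : ∀ y : EuclideanSpace ℝ (Fin (m + 1)),
      (1 + ‖y‖) ^ (-N) * (1 + ‖y‖) ^ (d * δ) = (1 + ‖y‖) ^ (-(N - d * δ)) := fun y => by
    rw [← Real.rpow_add (by positivity)]; congr 1; ring
  have hle1 : ∀ (y : EuclideanSpace ℝ (Fin (m + 1))) (M : ℝ), 0 ≤ M → (1 + ‖y‖) ^ (-M) ≤ 1 :=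
    fun y M hM => Real.rpow_le_one_of_one_le_of_nonpos (by linarith [norm_nonneg y]) (by linarith)
  have hM : ((m + 1 : ℕ) : ℝ) < N - d * δ := by linarith
  have hM0 : 0 ≤ N - d * δ := (Nat.cast_nonneg _).trans hM.le
  refine ⟨fun hqt => ?_, fun _ => ⟨D * C ^ δ, Filter.Eventually.of_forall fun y => ?_⟩⟩
  · have hq1 : 1 ≤ q.toReal := by simpa using ENNReal.toReal_mono hqt hq
    have hI := ((integrable_one_add_norm_rpow_neg hM).const_mul
      (D ^ q.toReal * C ^ δ)).lintegral_lt_top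
    refine lt_of_le_of_lt (lintegral_mono fun y => ENNReal.ofReal_le_ofReal ?_) hI
    have e : Real.exp (q.toReal * b * ‖y‖ ^ β) * ‖fourierHat f y‖ ^ q.toReal =
        (Real.exp (b * ‖y‖ ^ β) * ‖fourierHat f y‖) ^ q.toReal := by
      rw [Real.mul_rpow (by positivity) (by positivity), ← Real.exp_mul]
      ring_nf
    rw [e]
    have h1 : (Real.exp (b * ‖y‖ ^ β) * ‖fourierHat f y‖) ^ q.toReal ≤
        D ^ q.toReal * (1 + ‖y‖) ^ (-N) := by
      calc _ ≤ (D * (1 + ‖y‖) ^ (-N)) ^ q.toReal := Real.rpow_le_rpow (by positivity) (hb y) (by positivity)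
        _ = D ^ q.toReal * ((1 + ‖y‖) ^ (-N)) ^ q.toReal := Real.mul_rpow hD (by positivity)
        _ ≤ _ := by
          gcongr
          exact Real.rpow_le_self_of_le_one (by positivity) (hle1 y N hN0.le) hq1
    calc _ ≤ D ^ q.toReal * (1 + ‖y‖) ^ (-N) * (C ^ δ * (1 + ‖y‖) ^ (d * δ)) :=
          mul_le_mul h1 (hQδ y) (hQ0 y) (by positivity)
      _ = _ := by rw [mul_mul_mul_comm, hprod]
  · calc _ ≤ D * (1 + ‖y‖) ^ (-N) * (C ^ δ * (1 + ‖y‖) ^ (d * δ)) :=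
          mul_le_mul (hb y) (hQδ y) (hQ0 y) (by positivity)
      _ = D * C ^ δ * (1 + ‖y‖) ^ (-(N - d * δ)) := by rw [mul_mul_mul_comm, hprod]
      _ ≤ _ := mul_le_of_le_one_right (by positivity) (hle1 y _ hM0)

/-- A radial contour superposition of Gaussians. -/
noncomputable def radialSaddle (m : ℕ) (σ ℓ ν : ℝ) (x : EuclideanSpace ℝ (Fin (m + 1))) : ℂ :=
  saddleIntegral σ 1 (ℓ * ‖x‖ ^ 2) 0 ν

theorem continuous_radialSaddle (m : ℕ) {σ ℓ : ℝ} (hσ : 1 < σ) (hℓ : 0 < ℓ) (ν : ℝ) :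
    Continuous (radialSaddle m σ ℓ ν) :=
  (continuousOn_saddleIntegral hσ one_pos ν).comp_continuous (by fun_prop)
    fun x => by have := norm_nonneg x; exact Set.mem_Ici.2 (by positivity)

theorem linearIndependent_radialSaddle (m : ℕ) {σ ℓ : ℝ} (hσ : 1 < σ) (hℓ : 0 < ℓ) (ν : ℝ) :
    LinearIndependent ℂ fun j : ℕ => (AEEqFun.mk (radialSaddle m σ ℓ (ν - σ * j))
      (continuous_radialSaddle m hσ hℓ _).aestronglyMeasurable :
        EuclideanSpace ℝ (Fin (m + 1)) →ₘ[volume] ℂ) := by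
  rw [linearIndependent_iff']
  intro s g hsum
  have hae : ∀ t : Finset ℕ, ((∑ j ∈ t, g j • AEEqFun.mk (radialSaddle m σ ℓ (ν - σ * j))
      (continuous_radialSaddle m hσ hℓ _).aestronglyMeasurable :
        EuclideanSpace ℝ (Fin (m + 1)) →ₘ[volume] ℂ) : EuclideanSpace ℝ (Fin (m + 1)) → ℂ)
      =ᵐ[volume] fun x => ∑ j ∈ t, g j * radialSaddle m σ ℓ (ν - σ * j) x := by
    intro t
    induction t using Finset.induction_on with
    | empty => simp only [Finset.sum_empty]; exact AEEqFun.coeFn_zero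
    | insert j t hj ih =>
      simp only [Finset.sum_insert hj]
      filter_upwards [ih, AEEqFun.coeFn_add
        (g j • AEEqFun.mk (radialSaddle m σ ℓ (ν - σ * j))
          (continuous_radialSaddle m hσ hℓ _).aestronglyMeasurable :
          EuclideanSpace ℝ (Fin (m + 1)) →ₘ[volume] ℂ)
        (∑ j ∈ t, g j • AEEqFun.mk (radialSaddle m σ ℓ (ν - σ * j))
          (continuous_radialSaddle m hσ hℓ _).aestronglyMeasurable),
        AEEqFun.coeFn_smul (g j) (AEEqFun.mk (radialSaddle m σ ℓ (ν - σ * j))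
          (continuous_radialSaddle m hσ hℓ _).aestronglyMeasurable :
          EuclideanSpace ℝ (Fin (m + 1)) →ₘ[volume] ℂ),
        AEEqFun.coeFn_mk (radialSaddle m σ ℓ (ν - σ * j))
          (continuous_radialSaddle m hσ hℓ _).aestronglyMeasurable] with x h1 h2 h3 h4
      rw [h2, Pi.add_apply, h1, h3, Pi.smul_apply, h4, smul_eq_mul]
  have h0 : (fun x => ∑ j ∈ s, g j * radialSaddle m σ ℓ (ν - σ * j) x) =ᵐ[volume] fun _ => 0 := by
    refine (hae s).symm.trans ?_
    rw [hsum]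
    exact AEEqFun.coeFn_zero
  have h1 := (Continuous.ae_eq_iff_eq volume (continuous_finsetSum _ fun j _ =>
    continuous_const.mul (continuous_radialSaddle m hσ hℓ _)) continuous_const).1 h0
  refine eq_zero_of_sum_saddleIntegral_eq_zero hσ (ν := ν) fun r hr => ?_
  -- A point at which the radial variable `ℓ ‖x‖²` equals `r`.
  have h2 := congrFun h1 (EuclideanSpace.single 0 (Real.sqrt (r / ℓ)))
  have h3 : ℓ * ‖(EuclideanSpace.single 0 (Real.sqrt (r / ℓ)) :
      EuclideanSpace ℝ (Fin (m + 1)))‖ ^ 2 = r := by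
    rw [PiLp.norm_single, Real.norm_of_nonneg (Real.sqrt_nonneg _),
      Real.sq_sqrt (by positivity)]
    field_simp
  simpa only [Finset.sum_apply, Pi.mul_apply, radialSaddle, h3] using h2

theorem exists_linearIndependent_decay {m : ℕ} {a b α β δ : ℝ} (ha : 0 < a) (hα : 2 < α)
    (hαβ : α.HolderConjugate β) (hδ : 0 < δ) {p q : ℝ≥0∞} (hp : 1 ≤ p) (hq : 1 ≤ q)
    (Q : MvPolynomial (Fin (m + 1)) ℂ)
    (hab : (a * α) ^ (β - 1) * (b * β) = Real.sin (Real.pi / 2 * (β - 1))) :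
    ∃ (f : ℕ → EuclideanSpace ℝ (Fin (m + 1)) → ℂ)
      (hf : ∀ j, AEStronglyMeasurable (f j) volume),
      LinearIndependent ℂ (fun j => AEEqFun.mk (f j) (hf j)) ∧
      ∀ j, SpaceDecay a α p (f j) ∧ FourierDecay b β δ q Q (f j) := by
  have hα0 : 0 < α := hαβ.pos
  have hβ0 : 0 < β := hαβ.symm.pos
  have hα2 : 0 < α - 2 := by linarith
  have hα1 : 0 < α - 1 := by linarith
  have hβ : β = α / (α - 1) := hαβ.conjugate_eq
  -- The choice for which `s^(σ/(σ-1))` is `s^(α/2)`; it also turns `t^(σ/(σ+1))` into `t^(β/2)`.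
  set σ := α / (α - 2) with hσdef
  have hσ : 1 < σ := by rw [hσdef, lt_div_iff₀ hα2]; linarith
  have hσ0 : 0 < σ := by linarith
  -- Solves `(2/α) ℓ^(α/2) = a`.
  set ℓ := (a * α / 2) ^ (2 / α) with hℓdef
  have hℓ : 0 < ℓ := by positivity
  have c1 : σ / (σ - 1) = α / 2 := by
    have : σ - 1 = 2 / (α - 2) := by rw [hσdef]; field_simp; ring
    rw [this, hσdef]; field_simp
  have c2 : 1 - 1 / σ = 2 / α := by rw [hσdef]; field_simp; ring
  have c3' : σ + 1 = 2 * (α - 1) / (α - 2) := by rw [hσdef]; field_simp; ring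
  have c3 : σ / (σ + 1) = β / 2 := by
    rw [c3', hσdef, hβ]; field_simp
  have c4 : 1 + 1 / σ = 2 / β := by rw [hσdef, hβ]; field_simp; ring
  have c5 : Real.cos (sectorAngle σ) = Real.sin (Real.pi / 2 * (β - 1)) := by
    rw [← Real.cos_pi_div_two_sub, sectorAngle, c3', hβ]
    congr 1; field_simp; ring
  obtain ⟨C, d, hC, hQ⟩ := exists_polyAbs_le Q
  set N : ℝ := ((m + 1 : ℕ) : ℝ) + d * δ + 1 with hN
  have hdδ : 0 ≤ d * δ := by positivity
  have hN0 : 0 < N := by positivity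
  -- Meets the frequency requirement, hence also the weaker spatial one `ν ≤ -N (σ - 1)`; the
  -- further shifts by `-σ j` and by minus half the dimension only lower it.
  set ν := -N * (σ + 1) with hν
  have hνj : ∀ j : ℕ, ν - σ * j ≤ ν := fun j => by
    have : 0 ≤ σ * j := by positivity
    linarith
  refine ⟨fun j => radialSaddle m σ ℓ (ν - σ * j),
    fun j => (continuous_radialSaddle m hσ hℓ _).aestronglyMeasurable,
    linearIndependent_radialSaddle m hσ hℓ ν, fun j => ⟨?_, ?_⟩⟩
  · obtain ⟨D, hD⟩ := saddleIntegral_space_decay hσ hN0.le (ν := ν - σ * j)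
      ((hνj j).trans (by rw [hν]; nlinarith))
    obtain ⟨K, hK, hK'⟩ := exists_one_add_mul_sq_rpow_le hℓ hN0.le
    have hD0 : 0 ≤ D := by
      have := (norm_nonneg _).trans (hD 0 le_rfl)
      rw [c1, Real.zero_rpow (by positivity)] at this
      simpa using this
    refine spaceDecay_of_bound (D := D * K) (N := N) hp hα0.le
      (continuous_radialSaddle m hσ hℓ _) (by linarith) fun x => ?_
    have hx := hD (ℓ * ‖x‖ ^ 2) (by positivity)
    have e : (1 - 1 / σ) * (ℓ * ‖x‖ ^ 2) ^ (σ / (σ - 1)) = a * ‖x‖ ^ α := by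
      rw [c1, c2, Real.mul_rpow hℓ.le (by positivity), hℓdef, ← Real.rpow_mul (by positivity),
        ← Real.rpow_natCast, ← Real.rpow_mul (norm_nonneg _)]
      have e1 : 2 / α * (α / 2) = 1 := by field_simp
      have e2 : ((2 : ℕ) : ℝ) * (α / 2) = α := by push_cast; field_simp
      rw [e1, e2, Real.rpow_one]
      field_simp
    rw [neg_mul, e] at hx
    calc _ ≤ Real.exp (a * ‖x‖ ^ α) *
          (D * (1 + ℓ * ‖x‖ ^ 2) ^ (-N) * Real.exp (-(a * ‖x‖ ^ α))) := by
          gcongr; exact hx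
      _ = D * (1 + ℓ * ‖x‖ ^ 2) ^ (-N) := by
          rw [mul_left_comm, ← Real.exp_add]; simp
      _ ≤ D * (K * (1 + ‖x‖) ^ (-N)) := by gcongr; exact hK' _ (norm_nonneg x)
      _ = _ := by ring
  · obtain ⟨D, hD⟩ := saddleIntegral_frequency_decay hσ hN0.le
      (ν := ν - σ * j - ((m + 1 : ℕ) : ℝ) / 2)
      (by have : (0 : ℝ) ≤ ((m + 1 : ℕ) : ℝ) / 2 := by positivity
          linarith [hνj j])
    have hℓ4 : 0 < 1 / (4 * ℓ) := by positivity
    obtain ⟨K, hK, hK'⟩ := exists_one_add_mul_sq_rpow_le hℓ4 hN0.le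
    have hD0 : 0 ≤ D := by
      have := (norm_nonneg _).trans (hD 0 le_rfl)
      rw [Real.zero_rpow (by positivity)] at this
      simpa using this
    set G := (Real.pi / ℓ) ^ (((m + 1 : ℕ) : ℝ) / 2) with hG
    have hG0 : 0 ≤ G := by have := Real.pi_pos; positivity
    refine fourierDecay_of_bound (D := G * (D * K)) (N := N) hq hδ hC hQ (by linarith) fun y => ?_
    have hy := hD (1 / (4 * ℓ) * ‖y‖ ^ 2) (by positivity)
    have e : Real.cos (sectorAngle σ) * (1 + 1 / σ) *
        (1 / (4 * ℓ) * ‖y‖ ^ 2) ^ (σ / (σ + 1)) = b * ‖y‖ ^ β := by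
      rw [c3, c4, c5, Real.mul_rpow (by positivity) (by positivity),
        ← Real.rpow_natCast ‖y‖, ← Real.rpow_mul (norm_nonneg _)]
      have e2 : ((2 : ℕ) : ℝ) * (β / 2) = β := by push_cast; field_simp
      have e3 : (1 / (4 * ℓ)) ^ (β / 2) = 1 / (2 * (a * α) ^ (β - 1)) := by
        have e4 : (4 : ℝ) ^ (β / 2) = 2 ^ β := by
          rw [show (4 : ℝ) = 2 ^ (2 : ℝ) by norm_num, ← Real.rpow_mul two_pos.le]
          congr 1
        have e5 : ℓ ^ (β / 2) = (a * α) ^ (β - 1) / 2 ^ (β - 1) := by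
          rw [hℓdef, ← Real.rpow_mul (by positivity), ← Real.div_rpow (by positivity) two_pos.le]
          congr 1
          rw [hβ]; field_simp; ring
        have e6 : (2 : ℝ) ^ β = 2 * 2 ^ (β - 1) := by
          rw [← Real.rpow_one_add' two_pos.le (by linarith)]; congr 1; ring
        rw [Real.div_rpow zero_le_one (by positivity), Real.one_rpow,
          Real.mul_rpow (by norm_num) hℓ.le, e4, e5, e6]
        have : (0 : ℝ) < 2 ^ (β - 1) := by positivity
        field_simp
      rw [e2, e3, ← hab]
      have : 0 < (a * α) ^ (β - 1) := by positivity
      field_simp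
    rw [neg_mul, e] at hy
    have hF : fourierHat (radialSaddle m σ ℓ (ν - σ * j)) y = (G : ℂ) *
        saddleIntegral σ 1 0 (1 / (4 * ℓ) * ‖y‖ ^ 2) (ν - σ * j - ((m + 1 : ℕ) : ℝ) / 2) := by
      rw [one_div_mul_eq_div]
      exact fourierHat_saddleIntegral hσ hℓ _ y
    rw [hF, norm_mul, Complex.norm_real, Real.norm_of_nonneg hG0]
    calc _ ≤ Real.exp (b * ‖y‖ ^ β) * (G *
          (D * (1 + 1 / (4 * ℓ) * ‖y‖ ^ 2) ^ (-N) * Real.exp (-(b * ‖y‖ ^ β)))) := by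
          gcongr
      _ = G * (D * (1 + 1 / (4 * ℓ) * ‖y‖ ^ 2) ^ (-N)) *
          (Real.exp (b * ‖y‖ ^ β) * Real.exp (-(b * ‖y‖ ^ β))) := by ring
      _ = G * (D * (1 + 1 / (4 * ℓ) * ‖y‖ ^ 2) ^ (-N)) := by
          rw [← Real.exp_add]; simp
      _ ≤ G * (D * (K * (1 + ‖y‖) ^ (-N))) := by gcongr; exact hK' _ (norm_nonneg y)
      _ = _ := by ring

theorem theorem2p4 (n : ℕ) (hn : 1 ≤ n) (a b α β δ : ℝ) (ha : 0 < a) (hb : 0 < b)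
    (hα : 2 < α) (hαβ : 1 / α + 1 / β = 1) (hδ : 0 < δ)
    (p q : ℝ≥0∞) (hp : 1 ≤ p) (hq : 1 ≤ q)
    (Q : MvPolynomial (Fin n) ℂ) (hQ : Q ≠ 0) :
    ((a * α) ^ (1 / α) * (b * β) ^ (1 / β) > Real.sin (Real.pi / 2 * (β - 1)) ^ (1 / β) →
      ∀ f : EuclideanSpace ℝ (Fin n) → ℂ, AEStronglyMeasurable f volume →
        SpaceDecay a α p f → FourierDecay b β δ q Q f → f =ᵐ[volume] 0) ∧
    ((a * α) ^ (1 / α) * (b * β) ^ (1 / β) = Real.sin (Real.pi / 2 * (β - 1)) ^ (1 / β) →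
      ∃ (f : ℕ → EuclideanSpace ℝ (Fin n) → ℂ)
        (hf : ∀ j, AEStronglyMeasurable (f j) volume),
        LinearIndependent ℂ (fun j => AEEqFun.mk (f j) (hf j)) ∧
        ∀ j, SpaceDecay a α p (f j) ∧ FourierDecay b β δ q Q (f j)) := by
  obtain ⟨m, rfl⟩ : ∃ m, n = m + 1 := ⟨n - 1, by omega⟩
  have hconj : α.HolderConjugate β :=
    Real.holderConjugate_iff.2 ⟨by linarith, by simpa using hαβ⟩
  have hα0 : 0 < α := by linarith
  have hα1 : 0 < α - 1 := by linarith
  have hβ : β = α / (α - 1) := hconj.conjugate_eq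
  have hβ1 : 1 < β := hconj.symm.lt
  have hβ2 : β < 2 := by rw [hβ, div_lt_iff₀ hα1]; linarith
  have hβ0 : 0 < β := by linarith
  refine ⟨fun h f hfm hf hff =>
    ae_eq_zero_of_spaceDecay_of_fourierDecay ha hb hβ1 hβ2 hconj hδ hp hq hQ h hfm hf hff,
    fun h => exists_linearIndependent_decay ha hα hconj hδ hp hq Q ?_⟩
  have hS : 0 ≤ Real.sin (Real.pi / 2 * (β - 1)) := by
    have := Real.pi_pos
    apply Real.sin_nonneg_of_nonneg_of_le_pi
    · have : 0 ≤ β - 1 := by linarith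
      positivity
    · nlinarith
  -- The `β`-th power removes the roots, and `β/α = β - 1`.
  have h2 := congrArg (fun t : ℝ => t ^ β) h
  rw [Real.mul_rpow (by positivity) (by positivity), ← Real.rpow_mul (by positivity),
    ← Real.rpow_mul (by positivity), ← Real.rpow_mul hS, one_div_mul_cancel hβ0.ne', Real.rpow_one,
    Real.rpow_one] at h2
  rw [← h2]
  congr 2
  rw [hβ]; field_simp; ring
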